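/- **Model.** There are $n$ processes. Each process $i$ has a FIFO store buffer and a local dispatcher $d_i$; processes and dispatchers are called agents. A TSO state consists of a memory $\mathsf m:\mathsf{Var}\to\mathsf{Val}$ and the $n$ buffers. A process can write (append $(x,v)$ to its buffer), read $x$ (event $\mathtt{RfB}$: the latest item for $x$ in its own buffer is returned; event $\mathtt{RfM}$, if its buffer has no item for $x$: the value $\mathsf m(x)$ is returned), perform a fence $\mathtt F$ (enabled only if its buffer is empty), perform $\mathtt{RMW}(x,v_{\rm exp},v_{\rm new})$ (enabled only if its buffer is empty and $\mathsf m(x)=v_{\rm exp}$; sets $\mathsf m(x)=v_{\rm new}$), perform internal actions, among them $\mathtt{return}(O)$ for operation names $O$, or do nothing ($\bot$). A dispatcher $d_i$ can perform $\mathtt{prop}$ (enabled only if the buffer of $i$ is nonempty; removes the oldest item $(x,v)$ and sets $\mathsf m(x)=v$) or do nothing. The item created by the $k$-th write of $i$ has tag $\langle i,k\rangle$; this is also the tag of that write, of every $\mathtt{RfB}$ that reads the item, and of the $\mathtt{prop}$ that propagates it. $\mathtt{RfM}$, $\mathtt{RMW}$ and $\mathtt{prop}$ events are memory accesses of their variable.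 The local state of a process is the list of records of its non-null actions (a read is recorded with its value, but not its source) and of the operations invoked at it. A *run* is a sequence of global states (a TSO state and the local states) at times $0,1,2,\dots$ that starts with empty buffers and empty local states. In round $t+1$, which leads from time $t$ to time $t+1$, each agent $b$ performs one action that is enabled at time $t$, called the action at the node $\langle b,t\rangle$, and the environment invokes at most one operation at each process. The actions take effect one by one, those of the processes first, then those of the dispatchers, and then the invocations. The actions of a round contain no two conflicting memory accesses (accesses of the same variable, not both $\mathtt{RfM}$, and not a $\mathtt{prop}$ by $d_i$ together with an $\mathtt{RfM}$ by $i$), and $d_i$ does not propagate an item in a round in which $i$ reads that item from its buffer. No operation is invoked at a process before the previously invoked one has returned. A protocol $P$ assigns to each process and local state a nonempty set of actions; $r$ is a run of $P$ if every non-null action of a process belongs to the set that $P$ assigns to its local state at that time. Runs $r,r'$ are *locally equivalent*, $r\approx r'$, if for every process the same local states appear in $r$ and in $r'$. *Occurs before* in $r$ is the least transitive relation $\rightsquigarrow_r$ on nodes such that, for all times $t<t'$, agents $b,c$ and processes $i$: (1) $\langle b,t\rangle\rightsquigarrow_r\langle b,t'\rangle$; (2) $\langle i,t\rangle\rightsquigarrow_r\langle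 d_i,t'\rangle$ if the action at $\langle i,t\rangle$ is a write or $\mathtt{RfB}$ and the one at $\langle d_i,t'\rangle$ is a $\mathtt{prop}$ with the same tag; (3) $\langle b,t\rangle\rightsquigarrow_r\langle c,t'\rangle$ if both actions are memory accesses of the same variable, unless both are $\mathtt{RfM}$, or $b=d_j$, $c=j$ for some process $j$ and the actions are a $\mathtt{prop}$ and an $\mathtt{RfM}$ respectively; (4) $\langle d_i,t\rangle\rightsquigarrow_r\langle i,t'\rangle$ if the action at $\langle d_i,t\rangle$ is $\mathtt{prop}$ and the one at $\langle i,t'\rangle$ is $\mathtt F$ or $\mathtt{RMW}$. An (occurrence of an) *operation* $X$ of process $i$ that is invoked in round $t_s+1$ and whose matching return is performed by $i$ in round $t_e$ has $X.s=\langle i,t_s\rangle$ and $X.e=\langle i,t_e\rangle$; what happens at times $t$ with $t_s\le t<t_e$ happens *during* $X$, and what happens at times $t<t_e$ happens *before* $X.e$. It *contains a feedback loop* in $r$ if there is a node $\langle b,t\rangle$ with $b\notin\{i,d_i\}$ and $X.s\rightsquigarrow_r\langle b,t\rangle\rightsquigarrow_r X.e$. A run of $P$ is *fair* if a dispatcher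 whose buffer is nonempty eventually propagates, and a process that from some time on always has an enabled non-null action according to $P$ eventually moves. **Theorem.** Let $r$ be a run of a protocol $P$, and let $X$ be a completed operation of process $i$ in $r$ during which $i$ writes a tag $\kappa$. If 1. $X$ does not contain a feedback loop in $r$, and 2. $i$ does not perform an $\mathtt F$ or $\mathtt{RMW}$ action during $X$, then there is a run $r'$ of $P$ with $r'\approx r$ and with the same initial state in which $X$ (the operation of $i$ with the same name and the same index in the sequence of invocations at $i$) also completes, $\kappa$ is also written during $X$, and $\kappa$ is not propagated to memory before $X.e$. If $r$ is fair, then $r'$ can be chosen fair. -/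

import Mathlib

namespace TSO

/-- The agents: every process `i` comes with a local dispatcher `disp i`. -/
inductive Agent (n : ℕ) where
  | proc (i : Fin n)
  | disp (i : Fin n)
  deriving DecidableEq

/-- The actions that a protocol can prescribe to a process. `Op` is the type of operation names,
`Inn` the type of (further) internal actions, which do not touch the TSO state. -/
inductive Action (Var Val Op Inn : Type*) where
  | read (x : Var)
  | write (x : Var) (v : Val)
  | fence
  | rmw (x : Var) (vexp vnew : Val)
  | ret (o : Op)
  | inner (a : Inn)
  | null

/-- The records that make up a local state. A read is recorded with the value returned, but not
with its source (buffer or memory). -/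
inductive Record (Var Val Op Inn : Type*) where
  | read (x : Var) (v : Val)
  | write (x : Var) (v : Val)
  | fence
  | rmw (x : Var) (vexp vnew : Val)
  | ret (o : Op)
  | inner (a : Inn)
  | invoke (o : Op)

/-- The local state of a process: the history of its observations, oldest first. -/
abbrev LocalState (Var Val Op Inn : Type*) := List (Record Var Val Op Inn)

/-- What an agent does at a node. The natural number in `W`, `RfB` and `prop` is the tag of the item
that is written, read from the buffer, or propagated: at process `i` or dispatcher `disp i`,
the number `k` stands for the tag `⟨i, k⟩`, i.e. for the item created by the `k`-th write of `i`
(counted from `0`). -/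
inductive Event (Var Val Op Inn : Type*) where
  | W (x : Var) (v : Val) (k : ℕ)
  | RfB (x : Var) (v : Val) (k : ℕ)
  | RfM (x : Var) (v : Val)
  | RMW (x : Var) (vexp vnew : Val)
  | F
  | ret (o : Op)
  | inner (a : Inn)
  | prop (x : Var) (v : Val) (k : ℕ)
  | null

/-- An item of a store buffer; `tag` is the index of the write that created it. The tag is
bookkeeping only: no precondition depends on it. -/
structure Item (Var Val : Type*) where
  var : Var
  val : Val
  tag : ℕ

/-- A basic TSO state: the main memory and one store buffer for each process (oldest item first). -/
structure State (n : ℕ) (Var Val : Type*) where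
  mem : Var → Val
  buf : Fin n → List (Item Var Val)

/-- The transition of the TSO state that is caused by a single event at a single agent. -/
inductive Step {n : ℕ} {Var Val Op Inn : Type*} [DecidableEq Var] :
    State n Var Val → Agent n → Event Var Val Op Inn → State n Var Val → Prop
  | write (σ : State n Var Val) (i : Fin n) (x : Var) (v : Val) (k : ℕ) :
      Step σ (.proc i) (.W x v k)
        ⟨σ.mem, Function.update σ.buf i (σ.buf i ++ [⟨x, v, k⟩])⟩
  | readBuf (σ : State n Var Val) (i : Fin n) (x : Var) (v : Val) (k : ℕ)
      (β₁ β₂ : List (Item Var Val)) (hbuf : σ.buf i = β₁ ++ ⟨x, v, k⟩ :: β₂)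
      (hlast : ∀ c ∈ β₂, c.var ≠ x) :
      Step σ (.proc i) (.RfB x v k) σ
  | readMem (σ : State n Var Val) (i : Fin n) (x : Var)
      (hbuf : ∀ c ∈ σ.buf i, c.var ≠ x) :
      Step σ (.proc i) (.RfM x (σ.mem x)) σ
  | rmw (σ : State n Var Val) (i : Fin n) (x : Var) (vexp vnew : Val)
      (hbuf : σ.buf i = []) (hmem : σ.mem x = vexp) :
      Step σ (.proc i) (.RMW x vexp vnew) ⟨Function.update σ.mem x vnew, σ.buf⟩
  | fence (σ : State n Var Val) (i : Fin n) (hbuf : σ.buf i = []) :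
      Step σ (.proc i) .F σ
  | propagate (σ : State n Var Val) (i : Fin n) (x : Var) (v : Val) (k : ℕ)
      (β : List (Item Var Val)) (hbuf : σ.buf i = ⟨x, v, k⟩ :: β) :
      Step σ (.disp i) (.prop x v k)
        ⟨Function.update σ.mem x v, Function.update σ.buf i β⟩
  | ret (σ : State n Var Val) (i : Fin n) (o : Op) : Step σ (.proc i) (.ret o) σ
  | inner (σ : State n Var Val) (i : Fin n) (a : Inn) : Step σ (.proc i) (.inner a) σ
  | null (σ : State n Var Val) (b : Agent n) : Step σ b .null σ

/-- Performing a list of events one by one. -/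
inductive StepSeq {n : ℕ} {Var Val Op Inn : Type*} [DecidableEq Var] :
    State n Var Val → List (Agent n × Event Var Val Op Inn) → State n Var Val → Prop
  | nil (σ : State n Var Val) : StepSeq σ [] σ
  | cons {σ σ₁ σ₂ : State n Var Val} {b : Agent n} {e : Event Var Val Op Inn}
      {l : List (Agent n × Event Var Val Op Inn)}
      (head : Step σ b e σ₁) (tail : StepSeq σ₁ l σ₂) : StepSeq σ ((b, e) :: l) σ₂

/-- The order in which the agents act within a round: first the processes, then the dispatchers. -/
def agentOrder (n : ℕ) : List (Agent n) :=
  (List.finRange n).map Agent.proc ++ (List.finRange n).map Agent.disp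

section Events

variable {n : ℕ} {Var Val Op Inn : Type*}

/-- The action of which an event of a process is an occurrence. (`prop` events belong to dispatchers,
which follow no protocol.) -/
def Event.action : Event Var Val Op Inn → Action Var Val Op Inn
  | .W x v _ => .write x v
  | .RfB x _ _ => .read x
  | .RfM x _ => .read x
  | .RMW x vexp vnew => .rmw x vexp vnew
  | .F => .fence
  | .ret o => .ret o
  | .inner a => .inner a
  | .prop _ _ _ => .null
  | .null => .null

/-- The record that an event of a process adds to the local state of that process. -/
def Event.records : Event Var Val Op Inn → List (Record Var Val Op Inn)
  | .W x v _ => [.write x v]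
  | .RfB x v _ => [.read x v]
  | .RfM x v => [.read x v]
  | .RMW x vexp vnew => [.rmw x vexp vnew]
  | .F => [.fence]
  | .ret o => [.ret o]
  | .inner a => [.inner a]
  | .prop _ _ _ => []
  | .null => []

/-- The event is a memory access of the variable `x`. -/
def Event.Accesses (e : Event Var Val Op Inn) (x : Var) : Prop :=
  (∃ v, e = .RfM x v) ∨ (∃ vexp vnew, e = .RMW x vexp vnew) ∨ (∃ v k, e = .prop x v k)

def Event.IsRfM (e : Event Var Val Op Inn) : Prop := ∃ x v, e = .RfM x v

def Event.IsProp (e : Event Var Val Op Inn) : Prop := ∃ x v k, e = .prop x v k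

/-- The event is a fence or a read-modify-write. -/
def Event.IsSync (e : Event Var Val Op Inn) : Prop :=
  e = .F ∨ ∃ x vexp vnew, e = .RMW x vexp vnew

/-- A write event or a read-from-buffer event with tag number `k`. -/
def Event.UsesBuffer (e : Event Var Val Op Inn) (k : ℕ) : Prop :=
  (∃ x v, e = .W x v k) ∨ (∃ x v, e = .RfB x v k)

/-- `e` at `b` is a propagation by the dispatcher of a process and `e'` at `c` is a read from memory
by that same process. -/
def OwnPropRead (b : Agent n) (e : Event Var Val Op Inn) (c : Agent n)
    (e' : Event Var Val Op Inn) : Prop :=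
  ∃ i, b = .disp i ∧ c = .proc i ∧ e.IsProp ∧ e'.IsRfM

/-- Conflicting memory accesses `e` at `b` and `e'` at `c`. -/
def Conflicting (b : Agent n) (e : Event Var Val Op Inn) (c : Agent n)
    (e' : Event Var Val Op Inn) : Prop :=
  ¬ (e.IsRfM ∧ e'.IsRfM) ∧ (∃ x, e.Accesses x ∧ e'.Accesses x) ∧
    ¬ (OwnPropRead b e c e' ∨ OwnPropRead c e' b e)

/-- Number of writes performed so far, read off the local state. -/
def LocalState.numWrites (ℓ : LocalState Var Val Op Inn) : ℕ :=
  ℓ.countP fun | .write _ _ => true | _ => false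

/-- Number of operations invoked so far, read off the local state. -/
def LocalState.numInvokes (ℓ : LocalState Var Val Op Inn) : ℕ :=
  ℓ.countP fun | .invoke _ => true | _ => false

end Events

/-- A protocol: for every process and every local state a nonempty set of possible actions. -/
structure Protocol (n : ℕ) (Var Val Op Inn : Type*) where
  act : Fin n → LocalState Var Val Op Inn → Set (Action Var Val Op Inn)
  nonempty : ∀ i ℓ, (act i ℓ).Nonempty

/-- A TSO run. The joint action that leads from time `t` to time `t + 1` (round `t + 1`) is given by
the event `ev t b` of each agent `b`, i.e. what `b` does at node `⟨b, t⟩`, and by the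
invocations `inv t i` that the environment issues in that round. -/
structure Run (n : ℕ) (Var Val Op Inn : Type*) [DecidableEq Var] where
  tso : ℕ → State n Var Val
  loc : ℕ → Fin n → LocalState Var Val Op Inn
  ev : ℕ → Agent n → Event Var Val Op Inn
  inv : ℕ → Fin n → Option Op
  buf_zero : ∀ i, (tso 0).buf i = []
  loc_zero : ∀ i, loc 0 i = []
  /-- Every action of a joint action is enabled at the current state. -/
  enabled : ∀ t b, ∃ σ, Step (tso t) b (ev t b) σ
  /-- Joint actions contain no conflicting memory accesses. -/
  nonconflicting : ∀ t b c, b ≠ c → ¬ Conflicting b (ev t b) c (ev t c)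
  /-- An item is not propagated in the same round in which its owner reads it from the buffer. -/
  read_not_propagated : ∀ t i x v k y w,
    ev t (.proc i) = .RfB x v k → ev t (.disp i) ≠ .prop y w k
  /-- The `k`-th write of a process has tag number `k`. -/
  tag_write : ∀ t i x v k, ev t (.proc i) = .W x v k → k = (loc t i).numWrites
  tso_succ : ∀ t, StepSeq (tso t) ((agentOrder n).map fun b => (b, ev t b)) (tso (t + 1))
  loc_succ : ∀ t i, loc (t + 1) i =
    loc t i ++ (ev t (.proc i)).records ++ ((inv t i).map Record.invoke).toList
  /-- No operation is invoked at a process before the preceding one has returned. (Within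
  a round, the action of the process comes before the invocation.) -/
  inv_alternate : ∀ i t₁ t₂ o o₂, t₁ < t₂ → inv t₁ i = some o → inv t₂ i = some o₂ →
    ∃ u, t₁ < u ∧ u ≤ t₂ ∧ ev u (.proc i) = .ret o

namespace Run

variable {n : ℕ} {Var Val Op Inn : Type*} [DecidableEq Var]

/-- `r` is a run of the protocol `P`. -/
def IsRunOf (r : Run n Var Val Op Inn) (P : Protocol n Var Val Op Inn) : Prop :=
  ∀ t i, r.ev t (.proc i) ≠ .null → (r.ev t (.proc i)).action ∈ P.act i (r.loc t i)

/-- Local equivalence of runs: every process passes through the same local states. -/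
def LocallyEquiv (r r' : Run n Var Val Op Inn) : Prop :=
  ∀ j ℓ, (∃ t, r.loc t j = ℓ) ↔ (∃ t, r'.loc t j = ℓ)

/-- The occurs-before relation between nodes `⟨b, t⟩` of a run. -/
inductive OccursBefore (r : Run n Var Val Op Inn) : Agent n × ℕ → Agent n × ℕ → Prop
  | locality (b : Agent n) (t t' : ℕ) (h : t < t') : OccursBefore r (b, t) (b, t')
  | buffer (i : Fin n) (t t' : ℕ) (h : t < t') (k : ℕ)
      (huse : (r.ev t (.proc i)).UsesBuffer k)
      (hprop : ∃ x v, r.ev t' (.disp i) = .prop x v k) :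
      OccursBefore r (.proc i, t) (.disp i, t')
  | memory (b c : Agent n) (t t' : ℕ) (h : t < t') (x : Var)
      (hb : (r.ev t b).Accesses x) (hc : (r.ev t' c).Accesses x)
      (hreads : ¬ ((r.ev t b).IsRfM ∧ (r.ev t' c).IsRfM))
      (hown : ¬ OwnPropRead b (r.ev t b) c (r.ev t' c)) :
      OccursBefore r (b, t) (c, t')
  | sync (i : Fin n) (t t' : ℕ) (h : t < t')
      (hprop : (r.ev t (.disp i)).IsProp) (hsync : (r.ev t' (.proc i)).IsSync) :
      OccursBefore r (.disp i, t) (.proc i, t')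
  | trans (θ θ₁ θ₂ : Agent n × ℕ) (h₁ : OccursBefore r θ θ₁) (h₂ : OccursBefore r θ₁ θ₂) :
      OccursBefore r θ θ₂

/-- There is a feedback loop between the nodes `⟨i, t₁⟩` and `⟨i, t₂⟩`. -/
def FeedbackLoop (r : Run n Var Val Op Inn) (i : Fin n) (t₁ t₂ : ℕ) : Prop :=
  ∃ (b : Agent n) (t : ℕ), b ≠ .proc i ∧ b ≠ .disp i ∧
    r.OccursBefore (.proc i, t₁) (b, t) ∧ r.OccursBefore (b, t) (.proc i, t₂)

/-- The `m`-th operation of process `i` (counted from `0`) is an operation `o` that occurs between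
the nodes `⟨i, s⟩` and `⟨i, e⟩`: it is invoked in round `s + 1`, and its matching return,
the first `ret o` after the invocation, is performed in round `e`, i.e. at node `⟨i, e - 1⟩`. -/
def OpOccurs (r : Run n Var Val Op Inn) (i : Fin n) (m : ℕ) (o : Op) (s e : ℕ) : Prop :=
  r.inv s i = some o ∧ (r.loc s i).numInvokes = m ∧
    ∃ u, e = u + 1 ∧ s < u ∧ r.ev u (.proc i) = .ret o ∧
      ∀ w, s < w → w < u → r.ev w (.proc i) ≠ .ret o

/-- Process `i` writes the tag `⟨i, k⟩` at time `t`. -/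
def WritesTag (r : Run n Var Val Op Inn) (i : Fin n) (k t : ℕ) : Prop :=
  ∃ x v, r.ev t (.proc i) = .W x v k

/-- The tag `⟨i, k⟩` is propagated to memory at time `t`. -/
def PropagatesTag (r : Run n Var Val Op Inn) (i : Fin n) (k t : ℕ) : Prop :=
  ∃ x v, r.ev t (.disp i) = .prop x v k

/-- The action `a` of process `i` is enabled at time `t`. -/
def ActionEnabled (r : Run n Var Val Op Inn) (t : ℕ) (i : Fin n)
    (a : Action Var Val Op Inn) : Prop :=
  ∃ (e : Event Var Val Op Inn) (σ : State n Var Val), e.action = a ∧ Step (r.tso t) (.proc i) e σ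

/-- Fairness: a dispatcher with a nonempty buffer eventually propagates, and a process that
from some time on always has an enabled non-null action according to its protocol
eventually moves. -/
def Fair (r : Run n Var Val Op Inn) (P : Protocol n Var Val Op Inn) : Prop :=
  (∀ i t, (r.tso t).buf i ≠ [] → ∃ t', t ≤ t' ∧ (r.ev t' (.disp i)).IsProp) ∧
    ∀ i t, (∀ t', t ≤ t' → ∃ a ∈ P.act i (r.loc t' i), a ≠ .null ∧ r.ActionEnabled t' i a) →
      ∃ t', t ≤ t' ∧ r.ev t' (.proc i) ≠ .null

end Run

end TSO

/-!
The run `r'` delays, by `e` rounds, the propagations of the tag and all nodes before which one of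
them occurs, and performs the nodes before time `e` that remain in the same rounds as `r`. The nodes
performed at any time form a cut that is down-closed with respect to occurs before. This determines
the buffers, and also the value of every variable that is accessed next, since its stores are
ordered. The only thing that can change is that a process reads its own latest write from its
buffer instead of the memory, and this is invisible to it.

A path of occurs before from the dispatcher `d_i` back to `i` passes through another agent, which
makes a feedback loop with the write of the tag, or contains a fence or a read-modify-write of `i`.
Hence no node of `i` before `X.e` is delayed.
-/

namespace TSO

variable {n : ℕ} {Var Val Op Inn : Type*}

section Effects

/-- The process of an agent: `i` for both the process `i` and its dispatcher `d_i`. -/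
def Agent.owner : Agent n → Fin n
  | .proc i => i
  | .disp i => i

/-- The items that an event appends to the buffer of its process. -/
def Event.items : Event Var Val Op Inn → List (Item Var Val)
  | .W x v k => [⟨x, v, k⟩]
  | _ => []

/-- The number of items that an event removes from the front of the buffer of its dispatcher. -/
def Event.numProps : Event Var Val Op Inn → ℕ
  | .prop _ _ _ => 1
  | _ => 0

/-- The variable that an event changes in the memory, with the value that it stores there. -/
def Event.store : Event Var Val Op Inn → Option (Var × Val)
  | .RMW x _ v => some (x, v)
  | .prop x v _ => some (x, v)
  | _ => none

theorem Event.accesses_of_store_eq {e : Event Var Val Op Inn} {x : Var} {v : Val}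
    (h : e.store = some (x, v)) : e.Accesses x := by
  cases e <;> simp_all [Event.store, Event.Accesses]

theorem Event.not_isRfM_of_store_eq {e : Event Var Val Op Inn} {x : Var} {v : Val}
    (h : e.store = some (x, v)) : ¬ e.IsRfM := by
  cases e <;> simp_all [Event.store, Event.IsRfM]

theorem Event.numProps_of_not_isProp {e : Event Var Val Op Inn} (h : ¬ e.IsProp) :
    e.numProps = 0 := by
  cases e <;> simp_all [Event.numProps, Event.IsProp]

variable [DecidableEq Var]

/-- The effect of the event `e` of the agent `b` on the TSO state, whether or not `e` is enabled. -/
def State.apply (σ : State n Var Val) (b : Agent n) (e : Event Var Val Op Inn) :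
    State n Var Val where
  mem := match e.store with
    | some (x, v) => Function.update σ.mem x v
    | none => σ.mem
  buf := match b with
    | .proc i => Function.update σ.buf i (σ.buf i ++ e.items)
    | .disp i => Function.update σ.buf i ((σ.buf i).drop e.numProps)

variable {σ τ : State n Var Val} {a b : Agent n} {e f : Event Var Val Op Inn} {x : Var}

theorem State.apply_mem_of_store_eq {v : Val} (h : e.store = some (x, v)) :
    (σ.apply b e).mem x = v := by
  simp [State.apply, h]

theorem State.apply_mem_of_forall_store_ne (h : ∀ v, e.store ≠ some (x, v)) :
    (σ.apply b e).mem x = σ.mem x := by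
  rcases he : e.store with _ | ⟨y, v⟩
  · simp [State.apply, he]
  · have hxy : x ≠ y := by
      rintro rfl
      exact h v he
    simp [State.apply, he, hxy]

theorem State.apply_proc_buf (σ : State n Var Val) (j : Fin n) (e : Event Var Val Op Inn) :
    (σ.apply (.proc j) e).buf j = σ.buf j ++ e.items := by
  simp [State.apply]

theorem State.apply_disp_buf (σ : State n Var Val) (j : Fin n) (e : Event Var Val Op Inn) :
    (σ.apply (.disp j) e).buf j = (σ.buf j).drop e.numProps := by
  simp [State.apply]

theorem State.apply_buf_of_owner_ne {j : Fin n} (h : b.owner ≠ j) :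
    (σ.apply b e).buf j = σ.buf j := by
  cases b <;> exact Function.update_of_ne h.symm _ _

theorem Step.eq_apply (h : Step σ b e τ) : τ = σ.apply b e := by
  cases h with
  | propagate _ x v k β hβ => simp [State.apply, Event.store, Event.numProps, hβ]
  | null => cases b <;> simp [State.apply, Event.store, Event.items, Event.numProps]
  | _ => simp [State.apply, Event.store, Event.items]

theorem Step.not_isProp {j : Fin n} (h : Step σ (.proc j) e τ) : ¬ e.IsProp := by
  rintro ⟨x, v, k, rfl⟩
  cases h

theorem Step.isProp_or_eq_null {j : Fin n} (h : Step σ (.disp j) e τ) : e.IsProp ∨ e = .null := by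
  cases h with
  | propagate _ x v k => exact Or.inl ⟨x, v, k, rfl⟩
  | null => exact Or.inr rfl

theorem Step.exists_of_eqOn {σ' : State n Var Val} {j : Fin n} (h : Step σ (.proc j) e σ')
    (hbuf : τ.buf j = σ.buf j) (hmem : ∀ x, e.Accesses x → τ.mem x = σ.mem x) :
    ∃ τ', Step τ (.proc j) e τ' := by
  cases h with
  | write _ x v k => exact ⟨_, .write _ _ _ _ _⟩
  | readBuf _ x v k β₁ β₂ hβ hlast => exact ⟨_, .readBuf _ _ _ _ _ β₁ β₂ (hbuf.trans hβ) hlast⟩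
  | readMem _ x hx =>
    rw [← hmem x (Or.inl ⟨_, rfl⟩)]
    exact ⟨_, .readMem _ _ _ (by rwa [hbuf])⟩
  | rmw _ x vexp vnew hβ hx =>
    exact ⟨_, .rmw _ _ _ _ _ (hbuf.trans hβ) ((hmem x (Or.inr (Or.inl ⟨_, _, rfl⟩))).trans hx)⟩
  | fence _ hβ => exact ⟨_, .fence _ _ (hbuf.trans hβ)⟩
  | ret _ o => exact ⟨_, .ret _ _ _⟩
  | inner _ a => exact ⟨_, .inner _ _ _⟩
  | null => exact ⟨_, .null _ _⟩

theorem Step.exists_of_buf_eq_append {σ' : State n Var Val} {j : Fin n}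
    (h : Step σ (.disp j) e σ') {β : List (Item Var Val)} (hbuf : τ.buf j = σ.buf j ++ β) :
    ∃ τ', Step τ (.disp j) e τ' := by
  cases h with
  | propagate _ x v k γ hγ => exact ⟨_, .propagate _ _ _ _ _ (γ ++ β) (by rw [hbuf, hγ]; rfl)⟩
  | null => exact ⟨_, .null _ _⟩

theorem Step.exists_apply {σ' : State n Var Val} (h : Step σ b e σ') (hab : a ≠ b)
    (hown : ∀ j, b = .proc j → a.owner ≠ j) (hc : ¬ Conflicting a f b e) :
    ∃ τ, Step (σ.apply a f) b e τ := by
  cases b with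
  | proc j =>
    refine h.exists_of_eqOn (State.apply_buf_of_owner_ne (hown j rfl)) fun x hx =>
      State.apply_mem_of_forall_store_ne fun v hv => hc
        ⟨fun hr => Event.not_isRfM_of_store_eq hv hr.1, ⟨x, Event.accesses_of_store_eq hv, hx⟩, ?_⟩
    rintro (⟨i, rfl, hi, -⟩ | ⟨i, -, -, hp, -⟩)
    · cases hi
      exact hown j rfl rfl
    · exact h.not_isProp hp
  | disp j =>
    obtain ⟨β, hβ⟩ : ∃ β, (σ.apply a f).buf j = σ.buf j ++ β := by
      by_cases ha : a.owner = j
      · cases a with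
        | proc i =>
          cases ha
          exact ⟨_, σ.apply_proc_buf _ f⟩
        | disp i =>
          cases ha
          exact absurd rfl hab
      · exact ⟨[], by rw [State.apply_buf_of_owner_ne ha, List.append_nil]⟩
    exact h.exists_of_buf_eq_append hβ

end Effects

section Round

variable [DecidableEq Var] {σ τ : State n Var Val} {ev : Agent n → Event Var Val Op Inn} {x : Var}

/-- The TSO state after every agent `b` has performed `ev b`, in the order of a round. -/
def State.round (σ : State n Var Val) (ev : Agent n → Event Var Val Op Inn) : State n Var Val :=
  (agentOrder n).foldl (fun σ b => σ.apply b (ev b)) σ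

theorem foldl_eq_of_forall {α β γ : Type*} {f : β → α → β} {g : β → γ} {l : List α}
    (h : ∀ a ∈ l, ∀ b, g (f b a) = g b) (b : β) : g (l.foldl f b) = g b :=
  List.foldlRecOn l f (motive := fun b' => g b' = g b) rfl fun b' hb' a ha => (h a ha b').trans hb'

theorem mem_agentOrder (b : Agent n) : b ∈ agentOrder n := by
  cases b <;> simp [agentOrder]

theorem agentOrder_pairwise :
    (agentOrder n).Pairwise fun a b => a ≠ b ∧ ∀ j, b = .proc j → a.owner ≠ j := by
  have hfin := List.nodup_finRange n
  refine List.pairwise_append.2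
    ⟨List.pairwise_map.2 (hfin.imp fun hab => ?_), List.pairwise_map.2 (hfin.imp fun hab => ?_), ?_⟩
  all_goals simp_all [Agent.owner]

theorem exists_agentOrder_eq_append (j : Fin n) :
    ∃ l₁ l₂ l₃ : List (Agent n), agentOrder n = l₁ ++ .proc j :: (l₂ ++ .disp j :: l₃) ∧
      ∀ b ∈ l₁ ++ l₂ ++ l₃, b.owner ≠ j := by
  obtain ⟨p, q, hpq⟩ := List.append_of_mem (List.mem_finRange j)
  have hnodup : (p ++ j :: q).Nodup := hpq ▸ List.nodup_finRange n
  have hj : j ∉ p ++ q := (List.nodup_middle.1 hnodup).notMem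
  refine ⟨p.map .proc, q.map .proc ++ p.map .disp, q.map .disp, by simp [agentOrder, hpq], ?_⟩
  rintro b hb rfl
  cases b <;> simp_all [Agent.owner]

theorem State.round_buf (σ : State n Var Val) (ev : Agent n → Event Var Val Op Inn) (j : Fin n) :
    (σ.round ev).buf j = (σ.buf j ++ (ev (.proc j)).items).drop (ev (.disp j)).numProps := by
  obtain ⟨l₁, l₂, l₃, hl, hown⟩ := exists_agentOrder_eq_append j
  have hkeep : ∀ l : List (Agent n), (∀ b ∈ l, b ∈ l₁ ++ l₂ ++ l₃) → ∀ σ : State n Var Val,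
      (l.foldl (fun σ b => σ.apply b (ev b)) σ).buf j = σ.buf j := fun l h =>
    foldl_eq_of_forall (g := fun σ : State n Var Val => σ.buf j)
      fun b hb _ => State.apply_buf_of_owner_ne (hown b (h b hb))
  rw [State.round, hl]
  simp only [List.foldl_append, List.foldl_cons]
  rw [hkeep l₃ (by simp_all), apply_disp_buf, hkeep l₂ (by simp_all), apply_proc_buf,
    hkeep l₁ (by simp_all)]

theorem State.round_mem_of_forall_store_ne (h : ∀ b v, (ev b).store ≠ some (x, v)) :
    (σ.round ev).mem x = σ.mem x :=
  foldl_eq_of_forall (g := fun σ : State n Var Val => σ.mem x)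
    (fun b _ _ => State.apply_mem_of_forall_store_ne (h b)) σ

theorem State.round_mem_of_store_eq {v : Val} {b : Agent n} (hb : (ev b).store = some (x, v))
    (h : ∀ c v', c ≠ b → (ev c).store ≠ some (x, v')) : (σ.round ev).mem x = v := by
  obtain ⟨l₁, l₂, hl⟩ := List.append_of_mem (mem_agentOrder b)
  have hafter : ∀ c ∈ l₂, b ≠ c := by
    have hpair := (List.pairwise_append.1 (hl ▸ agentOrder_pairwise (n := n))).2.1
    exact fun c hc => ((List.pairwise_cons.1 hpair).1 c hc).1
  rw [State.round, hl, List.foldl_append, List.foldl_cons,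
    foldl_eq_of_forall (g := fun σ : State n Var Val => σ.mem x) fun c hc _ =>
      State.apply_mem_of_forall_store_ne fun v' => h c v' (hafter c hc).symm,
    State.apply_mem_of_store_eq hb]

theorem StepSeq.eq_foldl {l : List (Agent n)} (h : StepSeq σ (l.map fun b => (b, ev b)) τ) :
    τ = l.foldl (fun σ b => σ.apply b (ev b)) σ := by
  induction l generalizing σ with
  | nil => cases h; rfl
  | cons b l ih =>
    rcases h with _ | ⟨head, tail⟩
    rw [ih tail, head.eq_apply]
    rfl

theorem stepSeq_foldl (hc : ∀ a b, a ≠ b → ¬ Conflicting a (ev a) b (ev b)) {l : List (Agent n)}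
    (hl : l.Pairwise fun a b => a ≠ b ∧ ∀ j, b = .proc j → a.owner ≠ j)
    (he : ∀ b ∈ l, ∃ τ, Step σ b (ev b) τ) :
    StepSeq σ (l.map fun b => (b, ev b)) (l.foldl (fun σ b => σ.apply b (ev b)) σ) := by
  induction l generalizing σ with
  | nil => exact .nil σ
  | cons a l ih =>
    obtain ⟨hhead, htail⟩ := List.pairwise_cons.1 hl
    obtain ⟨τ, hτ⟩ := he a List.mem_cons_self
    obtain rfl := hτ.eq_apply
    refine .cons hτ (ih htail fun b hb => ?_)
    obtain ⟨τ, hτ⟩ := he b (List.mem_cons_of_mem _ hb)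
    obtain ⟨hab, hown⟩ := hhead b hb
    exact hτ.exists_apply hab hown (hc a b hab)

theorem State.stepSeq_round (hc : ∀ a b, a ≠ b → ¬ Conflicting a (ev a) b (ev b))
    (he : ∀ b, ∃ τ, Step σ b (ev b) τ) :
    StepSeq σ ((agentOrder n).map fun b => (b, ev b)) (σ.round ev) :=
  stepSeq_foldl hc agentOrder_pairwise fun b _ => he b

end Round

section Resolve

/-- `d` is the item of the buffer `β` from which a read of its variable is answered: the one for
that variable with the largest tag. -/
def IsLatest (β : List (Item Var Val)) (d : Item Var Val) : Prop :=
  d ∈ β ∧ ∀ d' ∈ β, d'.var = d.var → d'.tag ≤ d.tag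

theorem isLatest_iff_exists_append {β : List (Item Var Val)}
    (hβ : β.Pairwise fun d d' => d.tag < d'.tag) {d : Item Var Val} :
    IsLatest β d ↔ ∃ β₁ β₂, β = β₁ ++ d :: β₂ ∧ ∀ d' ∈ β₂, d'.var ≠ d.var := by
  constructor
  · rintro ⟨hd, hlast⟩
    obtain ⟨β₁, β₂, rfl⟩ := List.append_of_mem hd
    refine ⟨β₁, β₂, rfl, fun d' hd' hvar => ?_⟩
    have hlt : d.tag < d'.tag :=
      (List.pairwise_cons.1 (List.pairwise_append.1 hβ).2.1).1 d' hd'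
    exact hlt.not_ge (hlast d' (by simp [hd']) hvar)
  · rintro ⟨β₁, β₂, rfl, hlast⟩
    refine ⟨by simp, fun d' hd' hvar => ?_⟩
    rcases List.mem_append.1 hd' with h₁ | h₂
    · exact ((List.pairwise_append.1 hβ).2.2 d' h₁ d List.mem_cons_self).le
    · rcases List.mem_cons.1 h₂ with rfl | h₂
      exacts [le_rfl, absurd hvar (hlast d' h₂)]

variable [DecidableEq Var] {β : List (Item Var Val)} {e e' : Event Var Val Op Inn} {x : Var}

/-- The event `e` with a read from memory redirected to the latest matching item of the buffer `β`,
if there is one. The value read is not changed. -/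
def Event.resolve (β : List (Item Var Val)) : Event Var Val Op Inn → Event Var Val Op Inn
  | .RfM x v => match β.reverse.find? (fun d => d.var = x) with
    | some d => .RfB x v d.tag
    | none => .RfM x v
  | e => e

theorem Event.resolve_readMem_cases (β : List (Item Var Val)) (x : Var) (v : Val) :
    ((∀ d ∈ β, d.var ≠ x) ∧ (RfM x v : Event Var Val Op Inn).resolve β = .RfM x v) ∨
      ∃ β₁ d β₂, β = β₁ ++ d :: β₂ ∧ d.var = x ∧ (∀ d' ∈ β₂, d'.var ≠ d.var) ∧
        (RfM x v : Event Var Val Op Inn).resolve β = .RfB x v d.tag := by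
  rcases hfind : β.reverse.find? (fun d => d.var = x) with _ | d
  · exact Or.inl ⟨by simpa using hfind, by simp only [resolve, hfind]⟩
  · obtain ⟨hd, l₁, l₂, hl, hl₁⟩ := List.find?_eq_some_iff_append.1 hfind
    obtain rfl : d.var = x := by simpa using hd
    refine Or.inr ⟨l₂.reverse, d, l₁.reverse, ?_, rfl, by simpa using hl₁, ?_⟩
    · rw [← β.reverse_reverse, hl]
      simp
    · simp only [resolve, hfind]

theorem Event.resolve_cases (β : List (Item Var Val)) (e : Event Var Val Op Inn) :
    e.resolve β = e ∨
      ∃ v, ∃ d ∈ β, e = .RfM d.var v ∧ e.resolve β = .RfB d.var v d.tag := by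
  cases e with
  | RfM x v =>
    rcases resolve_readMem_cases (Op := Op) (Inn := Inn) β x v with
      ⟨-, h⟩ | ⟨β₁, d, β₂, rfl, rfl, -, h⟩
    · exact Or.inl h
    · exact Or.inr ⟨v, d, by simp, rfl, h⟩
  | _ => exact Or.inl rfl

theorem Event.apply_resolve {α : Type*} {f : Event Var Val Op Inn → α}
    (hf : ∀ x v k, f (.RfB x v k) = f (.RfM x v)) (e : Event Var Val Op Inn) :
    f (e.resolve β) = f e := by
  rcases e.resolve_cases β with h | ⟨v, d, -, h, h'⟩
  · rw [h]
  · rw [h', h, hf]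

theorem Event.resolve_eq_of_accesses (h : (e.resolve β).Accesses x) : e.resolve β = e := by
  rcases e.resolve_cases β with h' | ⟨v, d, -, -, h'⟩
  · exact h'
  · rw [h'] at h
    simp [Accesses] at h

theorem Event.resolve_eq_iff (he' : ∀ x, e'.action ≠ .read x) : e.resolve β = e' ↔ e = e' := by
  rcases e.resolve_cases β with h | ⟨v, d, -, h, h'⟩
  · rw [h]
  · rw [h', h]
    constructor <;> rintro rfl <;> exact absurd rfl (he' d.var)

end Resolve

namespace Run

variable [DecidableEq Var] (r : Run n Var Val Op Inn) {j : Fin n} {t u w k : ℕ} {x : Var} {v : Val}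

section Traces

/-- The items that process `j` writes before time `t`, oldest first. -/
def writes (j : Fin n) : ℕ → List (Item Var Val)
  | 0 => []
  | t + 1 => writes j t ++ (r.ev t (.proc j)).items

/-- The number of items that the dispatcher of process `j` propagates before time `t`. -/
def props (j : Fin n) : ℕ → ℕ
  | 0 => 0
  | t + 1 => props j t + (r.ev t (.disp j)).numProps

theorem tso_succ_eq (t : ℕ) : r.tso (t + 1) = (r.tso t).round (r.ev t) :=
  (r.tso_succ t).eq_foldl

theorem length_writes (j : Fin n) (t : ℕ) : (r.writes j t).length = (r.loc t j).numWrites := by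
  induction t with
  | zero => simp [writes, r.loc_zero, LocalState.numWrites]
  | succ t ih =>
    rw [r.loc_succ]
    simp only [writes, List.length_append, ih, LocalState.numWrites, List.countP_append]
    cases r.inv t j <;> cases r.ev t (.proc j) <;> simp [Event.items, Event.records]

variable {r}

theorem tag_eq_length_writes (h : r.ev t (.proc j) = .W x v k) : k = (r.writes j t).length :=
  (r.tag_write t j x v k h).trans (r.length_writes j t).symm

theorem getElem?_writes_eq_some_iff {p : ℕ} {d : Item Var Val} :
    (r.writes j t)[p]? = some d ↔
      d.tag = p ∧ ∃ w < t, r.ev w (.proc j) = .W d.var d.val d.tag := by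
  induction t with
  | zero => simp [writes]
  | succ t ih =>
    rw [Nat.exists_lt_succ_right, and_or_left, ← ih, writes]
    by_cases hW : ∃ x v k, r.ev t (.proc j) = .W x v k
    · obtain ⟨x, v, k, he⟩ := hW
      obtain rfl := tag_eq_length_writes he
      rcases d with ⟨y, w, l⟩
      rw [he, Event.items, List.getElem?_append]
      split_ifs with hp
      · simp only [Event.W.injEq, iff_self_or]
        omega
      · rw [List.getElem?_eq_none (not_lt.1 hp), List.getElem?_singleton]
        split_ifs with hp' <;> simp only [Option.some.injEq, Item.mk.injEq, Event.W.injEq,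
          false_or, false_iff] <;> grind
    · have hitems : (r.ev t (.proc j)).items = [] := by
        cases he : r.ev t (.proc j) <;> simp_all [Event.items]
      simp_all

theorem mem_drop_writes_iff {p : ℕ} {d : Item Var Val} :
    d ∈ (r.writes j t).drop p ↔
      p ≤ d.tag ∧ ∃ w < t, r.ev w (.proc j) = .W d.var d.val d.tag := by
  simp only [List.mem_iff_getElem?, List.getElem?_drop, getElem?_writes_eq_some_iff]
  exact ⟨fun ⟨q, hq, hw⟩ => ⟨by omega, hw⟩,
    fun ⟨hp, hw⟩ => ⟨d.tag - p, (Nat.add_sub_of_le hp).symm, hw⟩⟩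

theorem pairwise_writes : (r.writes j t).Pairwise fun d d' => d.tag < d'.tag := by
  rw [List.pairwise_iff_getElem]
  intro p q hp hq hpq
  have htag : ∀ p (_ : p < (r.writes j t).length), (r.writes j t)[p].tag = p := fun p hp =>
    (getElem?_writes_eq_some_iff.1 (List.getElem?_eq_getElem hp)).1
  rwa [htag, htag]

theorem write_unique {x' : Var} {v' : Val} (h : r.ev t (.proc j) = .W x v k)
    (h' : r.ev u (.proc j) = .W x' v' k) : x = x' ∧ v = v' := by
  have hget := getElem?_writes_eq_some_iff (r := r) (t := t + u + 1) (d := ⟨x, v, k⟩).2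
    ⟨rfl, t, by omega, h⟩
  rw [getElem?_writes_eq_some_iff (d := ⟨x', v', k⟩).2 ⟨rfl, u, by omega, h'⟩] at hget
  simp_all

theorem buf_eq_drop_and_props_le (j : Fin n) (t : ℕ) :
    (r.tso t).buf j = (r.writes j t).drop (r.props j t) ∧
      r.props j t ≤ (r.writes j t).length := by
  induction t with
  | zero => simp [writes, props, r.buf_zero]
  | succ t ih =>
    obtain ⟨hbuf, hle⟩ := ih
    refine ⟨?_, ?_⟩
    · rw [tso_succ_eq, State.round_buf, hbuf, ← List.drop_append_of_le_length hle, List.drop_drop]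
      rfl
    · obtain ⟨τ, hτ⟩ := r.enabled t (.disp j)
      simp only [writes, props, List.length_append]
      generalize r.ev t (.disp j) = e at hτ
      cases hτ with
      | propagate _ x v k β hβ =>
        have hpos : 0 < ((r.writes j t).drop (r.props j t)).length := by simp [← hbuf, hβ]
        rw [List.length_drop] at hpos
        simp only [Event.numProps]
        omega
      | null => exact hle.trans (Nat.le_add_right _ _)

theorem buf_eq_drop (j : Fin n) (t : ℕ) : (r.tso t).buf j = (r.writes j t).drop (r.props j t) :=
  (buf_eq_drop_and_props_le j t).1

theorem props_eq_and_exists_write_of_prop (h : r.ev u (.disp j) = .prop x v k) :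
    r.props j u = k ∧ ∃ w < u, r.ev w (.proc j) = .W x v k := by
  obtain ⟨τ, hτ⟩ := r.enabled u (.disp j)
  rw [h] at hτ
  cases hτ with
  | propagate _ _ _ _ β hβ =>
    have hhead : (r.writes j u)[r.props j u]? = some ⟨x, v, k⟩ := by
      rw [← List.head?_drop, ← buf_eq_drop, hβ, List.head?_cons]
    obtain ⟨htag, hw⟩ := getElem?_writes_eq_some_iff.1 hhead
    exact ⟨htag.symm, hw⟩

theorem lt_props_iff : k < r.props j t ↔ ∃ u < t, r.PropagatesTag j k u := by
  induction t with
  | zero => simp [props]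
  | succ t ih =>
    rw [Nat.exists_lt_succ_right, ← ih, props]
    by_cases hp : (r.ev t (.disp j)).IsProp
    · obtain ⟨x, v, l, he⟩ := hp
      obtain ⟨rfl, -⟩ := props_eq_and_exists_write_of_prop he
      simp only [PropagatesTag, he, Event.numProps, Event.prop.injEq]
      grind
    · rw [Event.numProps_of_not_isProp hp, Nat.add_zero, iff_self_or]
      rintro ⟨x, v, he⟩
      exact absurd ⟨x, v, k, he⟩ hp

theorem PropagatesTag.props_eq (h : r.PropagatesTag j k u) : r.props j u = k := by
  obtain ⟨x, v, he⟩ := h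
  exact (props_eq_and_exists_write_of_prop he).1

theorem PropagatesTag.lt_props_iff (h : r.PropagatesTag j k u) : k < r.props j t ↔ u < t := by
  refine ⟨fun hk => ?_, fun hu => Run.lt_props_iff.2 ⟨u, hu, h⟩⟩
  obtain ⟨u', hu', h'⟩ := Run.lt_props_iff.1 hk
  by_contra hut
  have hlt := Run.lt_props_iff.2 ⟨u', hu'.trans_le (not_lt.1 hut), h'⟩
  exact hlt.ne' h.props_eq

theorem PropagatesTag.ev_eq (h : r.PropagatesTag j k u) (hw : r.ev w (.proc j) = .W x v k) :
    r.ev u (.disp j) = .prop x v k := by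
  obtain ⟨x', v', he⟩ := h
  obtain ⟨-, w', -, hw'⟩ := props_eq_and_exists_write_of_prop he
  obtain ⟨rfl, rfl⟩ := write_unique hw hw'
  exact he

theorem exists_write_of_prop (h : r.ev u (.disp j) = .prop x v k) :
    ∃ w < u, r.ev w (.proc j) = .W x v k :=
  (props_eq_and_exists_write_of_prop h).2

theorem WritesTag.lt_of_propagatesTag (ht : r.WritesTag j k t)
    (hp : r.PropagatesTag j k u) : t < u := by
  obtain ⟨x, v, hw⟩ := ht
  obtain ⟨y, v', hprop⟩ := hp
  obtain ⟨w, hwu, hw'⟩ := exists_write_of_prop hprop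
  refine lt_of_le_of_lt (not_lt.1 fun hwt => ?_) hwu
  have hget := getElem?_writes_eq_some_iff (d := ⟨y, v', k⟩).2 ⟨rfl, w, hwt, hw'⟩
  exact (List.getElem?_eq_some_iff.1 hget).1.ne (tag_eq_length_writes hw)

theorem agent_eq_of_store_eq {b c : Agent n} {v' : Val} (hb : (r.ev t b).store = some (x, v))
    (hc : (r.ev t c).store = some (x, v')) : b = c := by
  have hbr := Event.not_isRfM_of_store_eq hb
  have hcr := Event.not_isRfM_of_store_eq hc
  by_contra hne
  refine r.nonconflicting t b c hne ⟨fun h => hbr h.1,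
    ⟨x, Event.accesses_of_store_eq hb, Event.accesses_of_store_eq hc⟩, ?_⟩
  rintro (⟨-, -, -, -, h⟩ | ⟨-, -, -, -, h⟩)
  exacts [hcr h, hbr h]

theorem mem_succ_of_store_eq {b : Agent n} (hb : (r.ev t b).store = some (x, v)) :
    (r.tso (t + 1)).mem x = v := by
  rw [tso_succ_eq]
  exact State.round_mem_of_store_eq hb fun c v' hc h => hc (agent_eq_of_store_eq h hb)

theorem mem_eq_of_forall_store_ne {t' : ℕ} (htt' : t ≤ t')
    (h : ∀ u b v, t ≤ u → u < t' → (r.ev u b).store ≠ some (x, v)) :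
    (r.tso t').mem x = (r.tso t).mem x := by
  induction htt' with
  | refl => rfl
  | @step m hm ih =>
    rw [tso_succ_eq, State.round_mem_of_forall_store_ne fun b v => h m b v hm m.lt_succ_self]
    exact ih fun u b v htu hum => h u b v htu (hum.trans m.lt_succ_self)

theorem OccursBefore.time_lt {θ θ' : Agent n × ℕ} (h : r.OccursBefore θ θ') : θ.2 < θ'.2 := by
  induction h with
  | trans _ _ _ _ _ ih₁ ih₂ => exact ih₁.trans ih₂
  | _ => assumption

end Traces

section Cuts

variable {r} {c c' : Agent n → ℕ} {σ : State n Var Val} {b : Agent n}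

variable (r) in
/-- A function `c : Agent n → ℕ` is viewed as a cut: the set of the nodes `⟨b, t⟩` with `t < c b`.
It is down-closed if it contains all predecessors of its nodes in the occurs-before relation. -/
def DownClosed (c : Agent n → ℕ) : Prop :=
  ∀ θ θ', r.OccursBefore θ θ' → θ'.2 < c θ'.1 → θ.2 < c θ.1

variable (r) in
/-- The node `⟨b, t⟩` is the first node of `b` outside the cut `c`, and its past lies in `c`. -/
structure Ready (c : Agent n → ℕ) (b : Agent n) (t : ℕ) : Prop where
  next : c b = t
  past : ∀ θ, r.OccursBefore θ (b, t) → θ.2 < c θ.1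

variable (r) in
/-- The cut `c'` arises from `c` by adding nodes of time `t` that are ready. -/
def CutStep (c c' : Agent n → ℕ) (t : ℕ) : Prop :=
  ∀ b, c' b = c b ∨ (r.Ready c b t ∧ c' b = t + 1)

variable (r) in
/-- The buffer of process `j` after the events of the cut `c`. -/
def cutBuf (c : Agent n → ℕ) (j : Fin n) : List (Item Var Val) :=
  (r.writes j (c (.proc j))).drop (r.props j (c (.disp j)))

variable (r) in
/-- The cut `c` contains the same stores to `x` as the cut of all nodes before time `T`. -/
def SameStores (c : Agent n → ℕ) (x : Var) (T : ℕ) : Prop :=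
  ∀ b t v, (r.ev t b).store = some (x, v) → (t < T ↔ t < c b)

variable (r) in
/-- The TSO state `σ` results from the events of the cut `c`. The value of a variable is prescribed
only if all its stores in `c` come, in `r`, before all its other stores. -/
structure IsCutState (c : Agent n → ℕ) (σ : State n Var Val) : Prop where
  buf : ∀ j, σ.buf j = r.cutBuf c j
  mem : ∀ x T, r.SameStores c x T → σ.mem x = (r.tso T).mem x

variable (r) in
/-- The event of the agent `b` in the round that extends the cut `c` to the cut `c'`. -/
def cutEvent (c c' : Agent n → ℕ) (b : Agent n) : Event Var Val Op Inn :=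
  if c' b = c b then .null else (r.ev (c b) b).resolve (r.cutBuf c b.owner)

theorem DownClosed.le_of_occursBefore {θ : Agent n × ℕ} (hc : r.DownClosed c) (hb : c b = t)
    (h : r.OccursBefore (b, t) θ) : c θ.1 ≤ θ.2 :=
  not_lt.1 fun hθ => (hc _ _ h hθ).ne hb.symm

theorem DownClosed.lt_iff_lt {a : Agent n} (hc : r.DownClosed c) (hr : r.Ready c b t)
    (hbefore : u < t → r.OccursBefore (a, u) (b, t))
    (hafter : t < u → r.OccursBefore (b, t) (a, u)) (hne : u = t → a = b) :
    u < t ↔ u < c a := by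
  rcases lt_trichotomy u t with h | rfl | h
  · exact iff_of_true h (hr.past _ (hbefore h))
  · rw [hne rfl, hr.next]
  · exact iff_of_false h.not_gt (hc.le_of_occursBefore hr.next (hafter h)).not_gt

theorem DownClosed.of_cutStep (hc : r.DownClosed c) (hs : r.CutStep c c' t) :
    r.DownClosed c' := by
  have hle : ∀ a, c a ≤ c' a := fun a => by
    rcases hs a with ha | ⟨hr, ha⟩
    · exact ha.ge
    · have := hr.next
      omega
  rintro θ ⟨b, u⟩ h hu
  refine lt_of_lt_of_le ?_ (hle θ.1)
  rcases hs b with hb | ⟨hr, hb⟩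
  · exact hc _ _ h (hb ▸ hu)
  · rcases (Nat.lt_succ_iff.1 (hb ▸ hu)).lt_or_eq with hut | rfl
    · exact hc _ _ h (hr.next.symm ▸ hut)
    · exact hr.past _ h

theorem mem_cutBuf_iff {d : Item Var Val} :
    d ∈ r.cutBuf c j ↔ r.props j (c (.disp j)) ≤ d.tag ∧
      ∃ w < c (.proc j), r.ev w (.proc j) = .W d.var d.val d.tag :=
  mem_drop_writes_iff

theorem mem_buf_iff {d : Item Var Val} :
    d ∈ (r.tso t).buf j ↔ r.props j t ≤ d.tag ∧
      ∃ w < t, r.ev w (.proc j) = .W d.var d.val d.tag := by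
  rw [buf_eq_drop, mem_drop_writes_iff]

theorem pairwise_cutBuf : (r.cutBuf c j).Pairwise fun d d' => d.tag < d'.tag :=
  pairwise_writes.drop

theorem pairwise_buf : ((r.tso t).buf j).Pairwise fun d d' => d.tag < d'.tag := by
  rw [buf_eq_drop]
  exact pairwise_writes.drop

theorem SameStores.mem_eq {T T' : ℕ} (h : r.SameStores c x T) (h' : r.SameStores c x T') :
    (r.tso T).mem x = (r.tso T').mem x := by
  wlog hle : T' ≤ T generalizing T T'
  · exact (this h' h (le_of_not_ge hle)).symm
  · refine mem_eq_of_forall_store_ne hle fun u b v hu hu' hv => ?_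
    have := h b u v hv
    have := h' b u v hv
    omega

theorem resolve_buf_eq (t : ℕ) (b : Agent n) :
    (r.ev t b).resolve ((r.tso t).buf b.owner) = r.ev t b := by
  rcases Event.resolve_cases ((r.tso t).buf b.owner) (r.ev t b) with h | ⟨v, d, hd, he, -⟩
  · exact h
  · obtain ⟨τ, hτ⟩ := r.enabled t b
    rw [he] at hτ
    cases hτ with
    | readMem _ _ hbuf => exact absurd rfl (hbuf d hd)

theorem cutEvent_of_eq (hb : c' b = c b) : r.cutEvent c c' b = .null :=
  if_pos hb

theorem cutEvent_of_ready (hr : r.Ready c b t) (hb : c' b = t + 1) :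
    r.cutEvent c c' b = (r.ev t b).resolve (r.cutBuf c b.owner) := by
  have hne : c' b ≠ c b := by
    have := hr.next
    omega
  rw [cutEvent, if_neg hne, hr.next]

theorem CutStep.cutEvent_cases (hs : r.CutStep c c' t) (b : Agent n) :
    (c' b = c b ∧ r.cutEvent c c' b = .null) ∨
      (r.Ready c b t ∧ c' b = t + 1 ∧
        r.cutEvent c c' b = (r.ev t b).resolve (r.cutBuf c b.owner)) := by
  rcases hs b with hb | ⟨hr, hb⟩
  · exact Or.inl ⟨hb, cutEvent_of_eq hb⟩
  · exact Or.inr ⟨hr, hb, cutEvent_of_ready hr hb⟩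

theorem CutStep.cutEvent_eq_of_accesses (hs : r.CutStep c c' t)
    (h : (r.cutEvent c c' b).Accesses x) :
    r.Ready c b t ∧ c' b = t + 1 ∧ r.cutEvent c c' b = r.ev t b := by
  rcases hs.cutEvent_cases b with ⟨-, he⟩ | ⟨hr, hb, he⟩
  · rw [he] at h
    simp [Event.Accesses] at h
  · rw [he] at h ⊢
    exact ⟨hr, hb, Event.resolve_eq_of_accesses h⟩

theorem CutStep.not_conflicting (hs : r.CutStep c c' t) {a : Agent n} (hab : a ≠ b) :
    ¬ Conflicting a (r.cutEvent c c' a) b (r.cutEvent c c' b) := by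
  intro h
  obtain ⟨x, ha, hb⟩ := h.2.1
  rw [(hs.cutEvent_eq_of_accesses ha).2.2, (hs.cutEvent_eq_of_accesses hb).2.2] at h
  exact r.nonconflicting t a b hab h

theorem CutStep.read_not_propagated (hs : r.CutStep c c' t) {y : Var} {v' : Val}
    (h : r.cutEvent c c' (.proc j) = .RfB x v k) : r.cutEvent c c' (.disp j) ≠ .prop y v' k := by
  intro h'
  obtain ⟨hrp, -, he⟩ := (hs.cutEvent_cases (.proc j)).resolve_left fun hnull => by
    simp [hnull.2] at h
  obtain ⟨hrd, -, he'⟩ := (hs.cutEvent_cases (.disp j)).resolve_left fun hnull => by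
    simp [hnull.2] at h'
  have hbuf : r.cutBuf c (Agent.proc j).owner = (r.tso t).buf (Agent.proc j).owner := by
    rw [buf_eq_drop, cutBuf]
    simp only [Agent.owner, hrp.next, hrd.next]
  rw [he, hbuf, resolve_buf_eq] at h
  rw [he', Event.resolve_eq_iff (by simp [Event.action])] at h'
  exact r.read_not_propagated t j x v k y v' h h'

theorem DownClosed.props_le_length_writes (hc : r.DownClosed c) (j : Fin n) :
    r.props j (c (.disp j)) ≤ (r.writes j (c (.proc j))).length := by
  by_contra! hlt
  obtain ⟨u, hu, x, v, he⟩ := lt_props_iff.1 hlt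
  obtain ⟨w, hwu, hw⟩ := exists_write_of_prop he
  have hwc := hc _ _ (.buffer j w u hwu _ (Or.inl ⟨x, v, hw⟩) ⟨x, v, he⟩) hu
  have hget := getElem?_writes_eq_some_iff (d := ⟨x, v, _⟩).2 ⟨rfl, w, hwc, hw⟩
  exact lt_irrefl _ (List.getElem?_eq_some_iff.1 hget).1

theorem DownClosed.cutBuf_eq (hc : r.DownClosed c) (hs : r.CutStep c c' t) (j : Fin n) :
    r.cutBuf c' j = (r.cutBuf c j ++ (r.cutEvent c c' (.proc j)).items).drop
      (r.cutEvent c c' (.disp j)).numProps := by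
  have hwrites : r.writes j (c' (.proc j)) =
      r.writes j (c (.proc j)) ++ (r.cutEvent c c' (.proc j)).items := by
    rcases hs.cutEvent_cases (.proc j) with ⟨hb, he⟩ | ⟨hr, hb, he⟩
    · simp [he, hb, Event.items]
    · rw [he, Event.apply_resolve (f := Event.items) fun _ _ _ => rfl, hb, hr.next]
      rfl
  have hprops : r.props j (c' (.disp j)) =
      r.props j (c (.disp j)) + (r.cutEvent c c' (.disp j)).numProps := by
    rcases hs.cutEvent_cases (.disp j) with ⟨hb, he⟩ | ⟨hr, hb, he⟩
    · simp [he, hb, Event.numProps]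
    · rw [he, Event.apply_resolve (f := Event.numProps) fun _ _ _ => rfl, hb, hr.next]
      rfl
  rw [cutBuf, cutBuf, hwrites, hprops,
    ← List.drop_append_of_le_length (hc.props_le_length_writes j), List.drop_drop]

theorem sameStores_of_accesses (hc : r.DownClosed c) (hr : r.Ready c b t)
    (hx : (r.ev t b).Accesses x)
    (hown : ∀ j u l, b = .proc j → (r.ev t b).IsRfM → (∃ v, r.ev u (.disp j) = .prop x v l) →
      (u < t ↔ u < c (.disp j))) :
    r.SameStores c x t := by
  intro a u v hv
  have hread := Event.not_isRfM_of_store_eq hv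
  have hacc := Event.accesses_of_store_eq hv
  by_cases ho : OwnPropRead a (r.ev u a) b (r.ev t b)
  · obtain ⟨j, rfl, hb, ⟨y, w, l, he⟩, hrfm⟩ := ho
    obtain ⟨rfl, rfl⟩ : y = x ∧ w = v := by simpa [he, Event.store] using hv
    exact hown j u l hb hrfm ⟨_, he⟩
  · have ho' : ¬ OwnPropRead b (r.ev t b) a (r.ev u a) := fun ⟨_, _, _, _, h⟩ => hread h
    refine hc.lt_iff_lt hr
      (fun hut => .memory a b u t hut x hacc hx (fun h => hread h.1) ho)
      (fun htu => .memory b a t u htu x hx hacc (fun h => hread h.2) ho') fun hut => ?_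
    subst hut
    by_contra hab
    exact r.nonconflicting u a b hab ⟨fun h => hread h.1, ⟨x, hacc, hx⟩, fun h => h.elim ho ho'⟩

theorem CutStep.sameStores_of_store_eq (hc : r.DownClosed c) (hs : r.CutStep c c' t)
    (hr : r.Ready c b t) (hb : c' b = t + 1) (hx : (r.ev t b).store = some (x, v)) :
    r.SameStores c' x (t + 1) := by
  have hsame : r.SameStores c x t :=
    sameStores_of_accesses hc hr (Event.accesses_of_store_eq hx)
      fun _ _ _ _ hrfm => absurd hrfm (Event.not_isRfM_of_store_eq hx)
  intro a u v' hv'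
  have hlt := hsame a u v' hv'
  rcases eq_or_ne u t with rfl | hut
  · rw [agent_eq_of_store_eq hv' hx, hb]
  · rcases hs a with ha | ⟨hra, ha⟩
    · omega
    · have := hra.next
      omega

theorem CutStep.sameStores_of_forall_store_ne (hs : r.CutStep c c' t) {T : ℕ}
    (hx : ∀ b v, (r.cutEvent c c' b).store ≠ some (x, v)) (hT : r.SameStores c' x T) :
    r.SameStores c x T := by
  intro a u v hv
  rw [hT a u v hv]
  rcases hs.cutEvent_cases a with ⟨ha, -⟩ | ⟨hr, ha, he⟩
  · rw [ha]
  · have hut : u ≠ t := by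
      rintro rfl
      refine hx a v ?_
      rw [he, Event.apply_resolve (f := Event.store) fun _ _ _ => rfl, hv]
    have := hr.next
    omega

theorem IsCutState.round (hσ : r.IsCutState c σ) (hc : r.DownClosed c) (hs : r.CutStep c c' t) :
    r.IsCutState c' (σ.round (r.cutEvent c c')) where
  buf j := by rw [State.round_buf, hσ.buf, ← hc.cutBuf_eq hs]
  mem x T hT := by
    have hstore : ∀ {a v}, (r.cutEvent c c' a).store = some (x, v) →
        r.Ready c a t ∧ c' a = t + 1 ∧ (r.ev t a).store = some (x, v) := by
      intro a v h
      obtain ⟨hr, ha, he⟩ := hs.cutEvent_eq_of_accesses (Event.accesses_of_store_eq h)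
      exact ⟨hr, ha, he ▸ h⟩
    by_cases hx : ∃ b v, (r.cutEvent c c' b).store = some (x, v)
    · obtain ⟨b, v, hbx⟩ := hx
      obtain ⟨hr, hb, hv⟩ := hstore hbx
      rw [State.round_mem_of_store_eq hbx fun a v' hab h =>
          hab (agent_eq_of_store_eq (hstore h).2.2 hv),
        ← mem_succ_of_store_eq hv, (hs.sameStores_of_store_eq hc hr hb hv).mem_eq hT]
    · push Not at hx
      rw [State.round_mem_of_forall_store_ne hx,
        hσ.mem x T (hs.sameStores_of_forall_store_ne hx hT)]

end Cuts

section Enabledness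

variable {r} {c c' : Agent n → ℕ} {σ : State n Var Val} {d : Item Var Val}

theorem Ready.cutBuf_eq_nil (hr : r.Ready c (.proc j) t) (hsync : (r.ev t (.proc j)).IsSync)
    (hbuf : (r.tso t).buf j = []) : r.cutBuf c j = [] := by
  refine List.eq_nil_iff_forall_not_mem.2 fun d hd => ?_
  obtain ⟨hle, w, hw, he⟩ := mem_cutBuf_iff.1 hd
  have hlt : d.tag < r.props j t := by
    by_contra! hge
    have hmem := mem_buf_iff.2 ⟨hge, w, hr.next ▸ hw, he⟩
    simp [hbuf] at hmem
  obtain ⟨u, hut, hprop⟩ := lt_props_iff.1 hlt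
  obtain ⟨x, v, he⟩ := id hprop
  have huc : u < c (.disp j) := hr.past _ (.sync j u t hut ⟨x, v, _, he⟩ hsync)
  exact hle.not_gt (hprop.lt_props_iff.2 huc)

theorem DownClosed.isLatest_cutBuf (hc : r.DownClosed c) (hj : c (.proc j) = t)
    (he : r.ev t (.proc j) = .RfB d.var d.val d.tag) (hd : IsLatest ((r.tso t).buf j) d) :
    IsLatest (r.cutBuf c j) d := by
  obtain ⟨hmem, hlast⟩ := hd
  obtain ⟨hle, hwrite⟩ := mem_buf_iff.1 hmem
  have hcle : r.props j (c (.disp j)) ≤ d.tag := by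
    by_contra! hlt
    obtain ⟨u, hu, y, w, hprop⟩ := lt_props_iff.1 hlt
    rcases lt_trichotomy u t with hut | rfl | htu
    · exact hle.not_gt (lt_props_iff.2 ⟨u, hut, y, w, hprop⟩)
    · exact r.read_not_propagated u j _ _ _ y w he hprop
    · exact (hc.le_of_occursBefore hj
        (.buffer j t u htu _ (Or.inr ⟨_, _, he⟩) ⟨y, w, hprop⟩)).not_gt hu
  refine ⟨mem_cutBuf_iff.2 ⟨hcle, hj ▸ hwrite⟩, fun d' hd' hvar => ?_⟩
  by_contra! hlt
  obtain ⟨-, hwrite'⟩ := mem_cutBuf_iff.1 hd'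
  exact hlt.not_ge (hlast d' (mem_buf_iff.2 ⟨hle.trans hlt.le, hj ▸ hwrite'⟩) hvar)

theorem Ready.exists_cutBuf_eq_cons (hr : r.Ready c (.disp j) t)
    (he : r.ev t (.disp j) = .prop x v k) : ∃ β, r.cutBuf c j = ⟨x, v, k⟩ :: β := by
  obtain ⟨hk, w, hwt, hw⟩ := props_eq_and_exists_write_of_prop he
  have hwc : w < c (.proc j) := hr.past _ (.buffer j w t hwt k (Or.inl ⟨x, v, hw⟩) ⟨x, v, he⟩)
  have hget := getElem?_writes_eq_some_iff (d := ⟨x, v, k⟩).2 ⟨rfl, w, hwc, hw⟩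
  obtain ⟨hlt, hitem⟩ := List.getElem?_eq_some_iff.1 hget
  exact ⟨_, by rw [cutBuf, hr.next, hk, List.drop_eq_getElem_cons hlt, hitem]⟩

theorem DownClosed.sameStores_of_readMem (hc : r.DownClosed c) (hr : r.Ready c (.proc j) t)
    (he : r.ev t (.proc j) = .RfM x v) (hbuf : ∀ d ∈ (r.tso t).buf j, d.var ≠ x)
    (hcut : ∀ d ∈ r.cutBuf c j, d.var ≠ x) : r.SameStores c x t := by
  refine sameStores_of_accesses hc hr (Or.inl ⟨v, he⟩) ?_
  rintro i u l hij - ⟨v', hprop⟩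
  obtain rfl : j = i := by simpa using hij
  obtain ⟨w, hwu, hw⟩ := exists_write_of_prop hprop
  have htag : r.PropagatesTag j l u := ⟨x, v', hprop⟩
  constructor
  · intro hut
    by_contra huc
    refine hcut ⟨x, v', l⟩ (mem_cutBuf_iff.2 ⟨?_, w, hr.next ▸ hwu.trans hut, hw⟩) rfl
    exact not_lt.1 fun h => huc (htag.lt_props_iff.1 h)
  · intro huc
    by_contra hut
    have hwt : w < c (.proc j) :=
      hc _ _ (.buffer j w u hwu l (Or.inl ⟨x, v', hw⟩) ⟨x, v', hprop⟩) huc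
    refine hbuf ⟨x, v', l⟩ (mem_buf_iff.2 ⟨?_, w, hr.next ▸ hwt, hw⟩) rfl
    exact not_lt.1 fun h => hut (htag.lt_props_iff.1 h)

-- The own latest item `d` is in the memory in `r`, but still in the buffer after `c`. A store that
-- overwrites it in `r` before the read would be in the past of the read, and then so would be the
-- propagation of `d`.
theorem Ready.mem_eq_of_isLatest_cutBuf (hr : r.Ready c (.proc j) t)
    (he : r.ev t (.proc j) = .RfM d.var v) (hbuf : ∀ d' ∈ (r.tso t).buf j, d'.var ≠ d.var)
    (hd : IsLatest (r.cutBuf c j) d) : (r.tso t).mem d.var = d.val := by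
  obtain ⟨hmem, hlast⟩ := hd
  obtain ⟨hle, w, hwc, hw⟩ := mem_cutBuf_iff.1 hmem
  have hlt : d.tag < r.props j t := not_le.1 fun hge =>
    hbuf d (mem_buf_iff.2 ⟨hge, w, hr.next ▸ hwc, hw⟩) rfl
  obtain ⟨u, hut, htag⟩ := lt_props_iff.1 hlt
  have huc : ¬ u < c (.disp j) := fun h => hle.not_gt (htag.lt_props_iff.2 h)
  have hstore : (r.ev u (.disp j)).store = some (d.var, d.val) := by rw [htag.ev_eq hw, Event.store]
  rw [mem_eq_of_forall_store_ne (Nat.succ_le_of_lt hut), mem_succ_of_store_eq hstore]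
  intro u' a v' huu' hut' hstore'
  have hread := Event.not_isRfM_of_store_eq hstore
  have hread' := Event.not_isRfM_of_store_eq hstore'
  have hacc' := Event.accesses_of_store_eq hstore'
  by_cases ho : OwnPropRead a (r.ev u' a) (.proc j) (r.ev t (.proc j))
  · obtain ⟨i, rfl, hij, ⟨y, v'', l, hprop⟩, -⟩ := ho
    obtain rfl : j = i := by simpa using hij
    obtain ⟨rfl, rfl⟩ : y = d.var ∧ v'' = v' := by simpa [hprop, Event.store] using hstore'
    obtain ⟨hl, w', hw', hwrite'⟩ := props_eq_and_exists_write_of_prop hprop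
    have hdl : d.tag < l := hl ▸ htag.lt_props_iff.2 huu'
    have hcut : ⟨d.var, v'', l⟩ ∈ r.cutBuf c j :=
      mem_cutBuf_iff.2 ⟨hle.trans hdl.le, w', hr.next ▸ hw'.trans hut', hwrite'⟩
    exact hdl.not_ge (hlast _ hcut rfl)
  · refine huc (hr.past _ (.trans _ (a, u') _
      (.memory _ a u u' huu' d.var (Event.accesses_of_store_eq hstore) hacc'
        (fun h => hread h.1) fun ⟨_, _, _, _, h⟩ => hread' h)
      (.memory a _ u' t hut' d.var hacc' (Or.inl ⟨v, he⟩) (fun h => hread' h.1) ho)))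

theorem IsCutState.exists_step_readMem (hσ : r.IsCutState c σ) (hc : r.DownClosed c)
    (hr : r.Ready c (.proc j) t) (he : r.ev t (.proc j) = .RfM x v)
    (hbuf : ∀ d ∈ (r.tso t).buf j, d.var ≠ x) (hmem : (r.tso t).mem x = v) :
    ∃ τ, Step σ (.proc j) ((.RfM x v : Event Var Val Op Inn).resolve (r.cutBuf c j)) τ := by
  rcases Event.resolve_readMem_cases (Op := Op) (Inn := Inn) (r.cutBuf c j) x v with
    ⟨hcut, hres⟩ | ⟨β₁, d, β₂, hβ, rfl, hlast, hres⟩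
  · rw [hres, ← hmem, ← hσ.mem x t (hc.sameStores_of_readMem hr he hbuf hcut)]
    exact ⟨_, .readMem _ _ _ (by rwa [hσ.buf j])⟩
  · have hd := (isLatest_iff_exists_append pairwise_cutBuf).2 ⟨β₁, β₂, hβ, hlast⟩
    rw [hres, ← hmem, hr.mem_eq_of_isLatest_cutBuf he hbuf hd]
    exact ⟨_, .readBuf _ _ _ _ _ β₁ β₂ ((hσ.buf j).trans hβ) hlast⟩

theorem IsCutState.exists_step_readBuf (hσ : r.IsCutState c σ) (hc : r.DownClosed c)
    (hj : c (.proc j) = t) (he : r.ev t (.proc j) = .RfB x v k)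
    (hd : IsLatest ((r.tso t).buf j) ⟨x, v, k⟩) :
    ∃ τ, Step σ (.proc j) (.RfB x v k : Event Var Val Op Inn) τ := by
  obtain ⟨β₁, β₂, hβ, hlast⟩ :=
    (isLatest_iff_exists_append pairwise_cutBuf).1 (hc.isLatest_cutBuf hj he hd)
  exact ⟨_, .readBuf _ _ _ _ _ β₁ β₂ ((hσ.buf j).trans hβ) hlast⟩

theorem IsCutState.exists_step_rmw (hσ : r.IsCutState c σ) (hc : r.DownClosed c)
    (hr : r.Ready c (.proc j) t) {v' : Val} (he : r.ev t (.proc j) = .RMW x v v')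
    (hbuf : (r.tso t).buf j = []) (hmem : (r.tso t).mem x = v) :
    ∃ τ, Step σ (.proc j) (.RMW x v v' : Event Var Val Op Inn) τ := by
  have hcut := hr.cutBuf_eq_nil (Or.inr ⟨x, v, v', he⟩) hbuf
  have hsame : r.SameStores c x t :=
    sameStores_of_accesses hc hr (Or.inr (Or.inl ⟨v, v', he⟩)) fun _ _ _ _ ⟨_, _, h⟩ => by
      simp [he] at h
  exact ⟨_, .rmw _ _ _ _ _ ((hσ.buf j).trans hcut) ((hσ.mem x t hsame).trans hmem)⟩

theorem IsCutState.exists_step_resolve (hσ : r.IsCutState c σ) (hc : r.DownClosed c)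
    {b : Agent n} (hr : r.Ready c b t) :
    ∃ τ, Step σ b ((r.ev t b).resolve (r.cutBuf c b.owner)) τ := by
  obtain ⟨τ, hτ⟩ := r.enabled t b
  generalize he : r.ev t b = e at hτ
  cases hτ with
  | write => exact ⟨_, .write _ _ _ _ _⟩
  | readBuf _ x v k β₁ β₂ hβ hlast =>
    exact hσ.exists_step_readBuf hc hr.next he
      ((isLatest_iff_exists_append pairwise_buf).2 ⟨β₁, β₂, hβ, hlast⟩)
  | readMem _ x hbuf => exact hσ.exists_step_readMem hc hr he hbuf rfl
  | rmw _ x v v' hbuf hmem => exact hσ.exists_step_rmw hc hr he hbuf hmem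
  | fence _ hbuf => exact ⟨_, .fence _ _ ((hσ.buf _).trans (hr.cutBuf_eq_nil (Or.inl he) hbuf))⟩
  | propagate _ x v k =>
    obtain ⟨β, hβ⟩ := hr.exists_cutBuf_eq_cons he
    exact ⟨_, .propagate _ _ _ _ _ β ((hσ.buf _).trans hβ)⟩
  | ret => exact ⟨_, .ret _ _ _⟩
  | inner => exact ⟨_, .inner _ _ _⟩
  | null => exact ⟨_, .null _ _⟩

theorem IsCutState.exists_step_cutEvent (hσ : r.IsCutState c σ) (hc : r.DownClosed c)
    (hs : r.CutStep c c' t) (b : Agent n) : ∃ τ, Step σ b (r.cutEvent c c' b) τ := by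
  rcases hs.cutEvent_cases b with ⟨-, he⟩ | ⟨hr, -, he⟩
  · rw [he]
    exact ⟨_, .null _ _⟩
  · rw [he]
    exact hσ.exists_step_resolve hc hr

end Enabledness

section Fairness

variable {r} {r' : Run n Var Val Op Inn} {P : Protocol n Var Val Op Inn}

theorem buf_ne_nil_of_forall_not_isProp (htu : t ≤ u) (hbuf : (r.tso t).buf j ≠ [])
    (h : ∀ w, t ≤ w → ¬ (r.ev w (.disp j)).IsProp) : (r.tso u).buf j ≠ [] := by
  induction htu with
  | refl => exact hbuf
  | @step m hm ih =>
    rw [tso_succ_eq, State.round_buf, Event.numProps_of_not_isProp (h m hm), List.drop_zero]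
    exact List.append_ne_nil_of_left_ne_nil ih _

theorem Fair.of_eventually_shift {δ : ℕ} (hr : r.Fair P)
    (h : ∀ᶠ t in Filter.atTop,
      r'.tso (t + δ) = r.tso t ∧ r'.loc (t + δ) = r.loc t ∧ r'.ev (t + δ) = r.ev t) :
    r'.Fair P := by
  obtain ⟨T, hT⟩ := Filter.eventually_atTop.1 h
  refine ⟨fun i t hbuf => ?_, fun i t hact => ?_⟩
  · by_contra! hno
    have hbuf' := buf_ne_nil_of_forall_not_isProp (u := max t T + δ) (by omega) hbuf hno
    rw [(hT _ (le_max_right t T)).1] at hbuf'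
    obtain ⟨u, hu, hprop⟩ := hr.1 i _ hbuf'
    refine hno (u + δ) (by omega) ?_
    rwa [(hT u (by omega)).2.2]
  · obtain ⟨u, hu, hmove⟩ := hr.2 i (max t T) fun u hu => by
      obtain ⟨htso, hloc, -⟩ := hT u (by omega)
      simpa only [ActionEnabled, htso, hloc] using hact (u + δ) (by omega)
    refine ⟨u + δ, by omega, ?_⟩
    rwa [(hT u (by omega)).2.2]

end Fairness

/-- A way to perform the events of a run in other rounds: round `t + 1` performs the events of `r`
at certain nodes of time `time t`, whereby the cut `cut t` of all events performed so far grows to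
`cut (t + 1)`. -/
structure Schedule where
  cut : ℕ → Agent n → ℕ
  time : ℕ → ℕ
  cut_zero : ∀ b, cut 0 b = 0
  cut_step : ∀ t, r.CutStep (cut t) (cut (t + 1)) (time t)

namespace Schedule

variable {r} (S : r.Schedule) {b : Agent n} {e : ℕ}

theorem downClosed (t : ℕ) : r.DownClosed (S.cut t) := by
  induction t with
  | zero =>
    intro θ θ' _ h
    simp [S.cut_zero] at h
  | succ t ih => exact ih.of_cutStep (S.cut_step t)

theorem cut_succ (t : ℕ) (b : Agent n) :
    S.cut (t + 1) b = S.cut t b ∨ S.cut (t + 1) b = S.cut t b + 1 := by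
  rcases S.cut_step t b with h | ⟨hr, h⟩
  · exact Or.inl h
  · exact Or.inr (hr.next.symm ▸ h)

theorem cut_mono (b : Agent n) : Monotone fun t => S.cut t b :=
  monotone_nat_of_le_succ fun t => by rcases S.cut_succ t b with h | h <;> omega

theorem exists_cut_eq {T : ℕ} (h : u < S.cut T b) :
    ∃ t < T, S.cut t b = u ∧ S.cut (t + 1) b = u + 1 := by
  induction T with
  | zero => simp [S.cut_zero] at h
  | succ T ih =>
    by_cases hT : u < S.cut T b
    · obtain ⟨t, ht, h'⟩ := ih hT
      exact ⟨t, ht.trans T.lt_succ_self, h'⟩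
    · refine ⟨T, T.lt_succ_self, ?_⟩
      rcases S.cut_succ T b with h' | h' <;> omega

/-- The events of the rescheduled run: those of `r`, up to the sources of the reads. -/
def ev (t : ℕ) : Agent n → Event Var Val Op Inn := r.cutEvent (S.cut t) (S.cut (t + 1))

/-- The TSO states of the rescheduled run. -/
def tso : ℕ → State n Var Val
  | 0 => r.tso 0
  | t + 1 => (tso t).round (S.ev t)

/-- The invocations of the rescheduled run. They keep to the action of their process that belongs
to the same round of `r`. -/
def inv (t : ℕ) (j : Fin n) : Option Op :=
  if S.cut (t + 1) (.proc j) = S.cut t (.proc j) + 1 then r.inv (S.cut t (.proc j)) j else none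

theorem isCutState (t : ℕ) : r.IsCutState (S.cut t) (S.tso t) := by
  induction t with
  | zero =>
    refine ⟨fun j => ?_, fun x T hT => ?_⟩
    · simp [tso, r.buf_zero, cutBuf, S.cut_zero, writes, props]
    · refine (mem_eq_of_forall_store_ne T.zero_le fun u b v _ hu hv => ?_).symm
      have := (hT b u v hv).1 hu
      simp [S.cut_zero] at this
  | succ t ih => exact ih.round (S.downClosed t) (S.cut_step t)

theorem cut_succ_of_ev_ne_null (h : S.ev t b ≠ .null) : S.cut (t + 1) b = S.cut t b + 1 :=
  (S.cut_succ t b).resolve_left fun h' => h (cutEvent_of_eq h')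

theorem ev_eq_resolve (h : S.cut (t + 1) b = S.cut t b + 1) :
    S.ev t b = (r.ev (S.cut t b) b).resolve (r.cutBuf (S.cut t) b.owner) := by
  rw [ev, cutEvent, if_neg (by omega)]

theorem ev_eq_iff (h : S.cut (t + 1) b = S.cut t b + 1) {e' : Event Var Val Op Inn}
    (he' : ∀ x, e'.action ≠ .read x) : S.ev t b = e' ↔ r.ev (S.cut t b) b = e' := by
  rw [S.ev_eq_resolve h, Event.resolve_eq_iff he']

theorem inv_eq_some_iff {o : Op} : S.inv t j = some o ↔
    S.cut (t + 1) (.proc j) = S.cut t (.proc j) + 1 ∧ r.inv (S.cut t (.proc j)) j = some o := by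
  simp [inv]

theorem loc_cut_succ (t : ℕ) (j : Fin n) :
    r.loc (S.cut (t + 1) (.proc j)) j = r.loc (S.cut t (.proc j)) j ++
      (S.ev t (.proc j)).records ++ ((S.inv t j).map Record.invoke).toList := by
  rcases S.cut_succ t (.proc j) with h | h
  · rw [h, ev, cutEvent_of_eq h, inv, if_neg (by omega)]
    simp [Event.records]
  · rw [h, r.loc_succ, S.ev_eq_resolve h,
      Event.apply_resolve (f := Event.records) fun _ _ _ => rfl, inv, if_pos h]

theorem exists_ret_of_inv {t₁ t₂ : ℕ} {o o₂ : Op} (ht : t₁ < t₂) (h₁ : S.inv t₁ j = some o)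
    (h₂ : S.inv t₂ j = some o₂) : ∃ u, t₁ < u ∧ u ≤ t₂ ∧ S.ev u (.proc j) = .ret o := by
  obtain ⟨hs₁, hi₁⟩ := S.inv_eq_some_iff.1 h₁
  obtain ⟨hs₂, hi₂⟩ := S.inv_eq_some_iff.1 h₂
  have hlt : S.cut t₁ (.proc j) < S.cut t₂ (.proc j) :=
    (Nat.lt_of_succ_le hs₁.ge).trans_le (S.cut_mono (.proc j) (Nat.succ_le_of_lt ht))
  obtain ⟨u, hu₁, hu₂, hret⟩ := r.inv_alternate j _ _ o o₂ hlt hi₁ hi₂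
  obtain ⟨w, hw, rfl, hwu⟩ :=
    S.exists_cut_eq (b := .proc j) (u := u) (T := t₂ + 1) (by omega)
  exact ⟨w, (S.cut_mono (.proc j)).reflect_lt hu₁, Nat.lt_succ_iff.1 hw,
    (S.ev_eq_iff hwu (by simp [Event.action])).2 hret⟩

/-- The run that performs the events of `r` according to the schedule. -/
def run : Run n Var Val Op Inn where
  tso := S.tso
  loc t j := r.loc (S.cut t (.proc j)) j
  ev := S.ev
  inv := S.inv
  buf_zero := r.buf_zero
  loc_zero j := by rw [S.cut_zero, r.loc_zero]
  enabled t b := (S.isCutState t).exists_step_cutEvent (S.downClosed t) (S.cut_step t) b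
  nonconflicting t _ _ hab := (S.cut_step t).not_conflicting hab
  read_not_propagated t _ _ _ _ _ _ h := (S.cut_step t).read_not_propagated h
  tag_write t j x v k h := by
    have hs := S.cut_succ_of_ev_ne_null (t := t) (b := .proc j) (by simp [h])
    exact r.tag_write _ j x v k ((S.ev_eq_iff hs (by simp [Event.action])).1 h)
  tso_succ t := State.stepSeq_round (fun _ _ => (S.cut_step t).not_conflicting)
    ((S.isCutState t).exists_step_cutEvent (S.downClosed t) (S.cut_step t))
  loc_succ := S.loc_cut_succ
  inv_alternate _ _ _ _ _ := S.exists_ret_of_inv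

theorem isRunOf_run {P : Protocol n Var Val Op Inn} (hP : r.IsRunOf P) : S.run.IsRunOf P := by
  intro t j h
  have hs := S.cut_succ_of_ev_ne_null h
  have haction : (S.ev t (.proc j)).action = (r.ev (S.cut t (.proc j)) (.proc j)).action := by
    rw [S.ev_eq_resolve hs, Event.apply_resolve (f := Event.action) fun _ _ _ => rfl]
  change (S.ev t (.proc j)).action ∈ _
  rw [haction]
  exact hP _ j fun h' => h ((S.ev_eq_iff hs (by simp [Event.action])).2 h')

theorem tso_eq {T : ℕ} (h : ∀ b, S.cut t b = T) : S.tso t = r.tso T := by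
  obtain ⟨hbuf, hmem⟩ := S.isCutState t
  have hbuf' : (S.tso t).buf = (r.tso T).buf := funext fun j => by
    rw [hbuf, buf_eq_drop, cutBuf, h, h]
  have hmem' : (S.tso t).mem = (r.tso T).mem := funext fun x =>
    hmem x T fun b u v _ => by rw [h]
  cases hσ : S.tso t
  cases hτ : r.tso T
  simp_all

variable {S}

variable (S) in
/-- From some time on, the rescheduled run repeats the rounds of `r` with the delay `δ`. -/
def EventuallyLags (δ : ℕ) : Prop :=
  ∀ᶠ t in Filter.atTop, ∀ b, S.cut (t + δ) b = t

variable (S) in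
/-- The agent `b` performs its first `e` events in the same rounds as in `r`. -/
def Punctual (b : Agent n) (e : ℕ) : Prop :=
  ∀ u ≤ e, S.cut u b = u

theorem EventuallyLags.locallyEquiv_run {δ : ℕ} (hS : S.EventuallyLags δ) :
    r.LocallyEquiv S.run := by
  refine fun j ℓ => ⟨?_, fun ⟨t, ht⟩ => ⟨_, ht⟩⟩
  rintro ⟨t, rfl⟩
  obtain ⟨T, hT, htT⟩ := (hS.and (Filter.eventually_gt_atTop t)).exists
  obtain ⟨u, -, hu, -⟩ := S.exists_cut_eq (htT.trans_eq (hT (.proc j)).symm)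
  exact ⟨u, congrArg (r.loc · j) hu⟩

theorem EventuallyLags.fair_run {δ : ℕ} (hS : S.EventuallyLags δ) {P : Protocol n Var Val Op Inn}
    (hr : r.Fair P) : S.run.Fair P := by
  refine hr.of_eventually_shift (δ := δ) ?_
  filter_upwards [hS, (Filter.tendsto_add_atTop_nat 1).eventually hS] with t ht ht'
  refine ⟨S.tso_eq ht, funext fun j => congrArg (r.loc · j) (ht _), funext fun b => ?_⟩
  have hs : S.cut (t + δ + 1) b = S.cut (t + δ) b + 1 := by
    rw [ht, Nat.add_right_comm, ht']
  have hbuf : r.cutBuf (S.cut (t + δ)) b.owner = (r.tso t).buf b.owner := by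
    rw [buf_eq_drop, cutBuf, ht, ht]
  exact (S.ev_eq_resolve hs).trans (by rw [ht, hbuf, resolve_buf_eq])

theorem Punctual.ev_eq_iff {i : Fin n} (hS : S.Punctual (.proc i) e) (ht : t < e)
    {e' : Event Var Val Op Inn} (he' : ∀ x, e'.action ≠ .read x) :
    S.run.ev t (.proc i) = e' ↔ r.ev t (.proc i) = e' := by
  have hs : S.cut (t + 1) (.proc i) = S.cut t (.proc i) + 1 := by
    rw [hS t ht.le, hS (t + 1) ht]
  have hev := Schedule.ev_eq_iff S hs he'
  rwa [hS t ht.le] at hev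

theorem Punctual.opOccurs_run {i : Fin n} {m s : ℕ} {o : Op} (hS : S.Punctual (.proc i) e)
    (hX : r.OpOccurs i m o s e) : S.run.OpOccurs i m o s e := by
  obtain ⟨hinv, hindex, u, rfl, hsu, hret, hfirst⟩ := hX
  have hret_iff : ∀ w < u + 1, S.run.ev w (.proc i) = .ret o ↔ r.ev w (.proc i) = .ret o :=
    fun w hw => hS.ev_eq_iff hw (by simp [Event.action])
  have hs : S.cut s (.proc i) = s := hS s (by omega)
  refine ⟨S.inv_eq_some_iff.2 ⟨?_, by rwa [hs]⟩, ?_, u, rfl, hsu,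
    (hret_iff u u.lt_succ_self).2 hret,
    fun w hsw hwu h => hfirst w hsw hwu ((hret_iff w (by omega)).1 h)⟩
  · rw [hs, hS (s + 1) (by omega)]
  · change (r.loc (S.cut s (.proc i)) i).numInvokes = m
    rwa [hs]

theorem Punctual.writesTag_run {i : Fin n} (hS : S.Punctual (.proc i) e) (ht : t < e)
    (h : r.WritesTag i k t) : S.run.WritesTag i k t := by
  obtain ⟨x, v, hw⟩ := h
  exact ⟨x, v, (hS.ev_eq_iff ht (by simp [Event.action])).2 hw⟩

theorem cut_lt_and_propagatesTag_of_run {i : Fin n} (h : S.run.PropagatesTag i k t) :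
    S.cut t (.disp i) < S.cut (t + 1) (.disp i) ∧ r.PropagatesTag i k (S.cut t (.disp i)) := by
  obtain ⟨x, v, he : S.ev t (.disp i) = _⟩ := h
  have hs := S.cut_succ_of_ev_ne_null (t := t) (b := .disp i) (by simp [he])
  exact ⟨hs ▸ Nat.lt_succ_self _, x, v, (S.ev_eq_iff hs (by simp [Event.action])).1 he⟩

end Schedule

section Postponing

/-- The nodes of `Θ` and those before which a node of `Θ` occurs. -/
def future (Θ : Set (Agent n × ℕ)) : Set (Agent n × ℕ) :=
  {θ' | ∃ θ ∈ Θ, θ' = θ ∨ r.OccursBefore θ θ'}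

/-- The cut of the nodes before time `e` that are not in the future of `Θ`. -/
noncomputable def cutAvoiding (Θ : Set (Agent n × ℕ)) (e : ℕ) (b : Agent n) : ℕ :=
  sInf {t | e ≤ t ∨ (b, t) ∈ r.future Θ}

variable {r} {Θ : Set (Agent n × ℕ)} {e : ℕ} {b : Agent n} {θ θ' : Agent n × ℕ}

theorem OccursBefore.mem_future (h : r.OccursBefore θ θ') (hθ : θ ∈ r.future Θ) :
    θ' ∈ r.future Θ := by
  obtain ⟨θ₀, hθ₀, rfl | h₀⟩ := hθ
  exacts [⟨θ, hθ₀, Or.inr h⟩, ⟨θ₀, hθ₀, Or.inr (.trans _ _ _ h₀ h)⟩]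

theorem lt_cutAvoiding_iff : t < r.cutAvoiding Θ e b ↔ t < e ∧ (b, t) ∉ r.future Θ := by
  have hne : {t | e ≤ t ∨ (b, t) ∈ r.future Θ}.Nonempty := ⟨e, Or.inl le_rfl⟩
  constructor
  · intro h
    have hnot := Nat.notMem_of_lt_sInf h
    simpa only [Set.mem_ofPred_eq, not_or, not_le] using hnot
  · rintro ⟨hte, ht⟩
    by_contra! hle
    rcases Nat.sInf_mem hne with h | h
    · exact (h.trans hle).not_gt hte
    · rcases hle.lt_or_eq with hlt | heq
      · exact ht (OccursBefore.mem_future (.locality b _ t hlt) h)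
      · exact ht (heq ▸ h)

theorem cutAvoiding_le : r.cutAvoiding Θ e b ≤ e :=
  Nat.sInf_le (Or.inl le_rfl)

theorem downClosed_cutAvoiding : r.DownClosed (r.cutAvoiding Θ e) := by
  rintro ⟨a, t⟩ ⟨b, u⟩ h hu
  obtain ⟨hue, hmem⟩ := lt_cutAvoiding_iff.1 hu
  exact lt_cutAvoiding_iff.2 ⟨h.time_lt.trans hue, fun ht => hmem (h.mem_future ht)⟩

variable (r Θ e) in
/-- The schedule that performs the nodes before time `e` that are not in the future of `Θ` in the
same rounds as `r`, and then all other nodes with the delay `e`. -/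
noncomputable def Schedule.postpone : r.Schedule where
  cut t b := max (min t (r.cutAvoiding Θ e b)) (t - e)
  time t := if t < e then t else t - e
  cut_zero b := by simp
  cut_step t b := by
    have hle := cutAvoiding_le (r := r) (Θ := Θ) (e := e) (b := b)
    dsimp only
    split_ifs with hte
    · by_cases ht : t < r.cutAvoiding Θ e b
      · refine Or.inr ⟨⟨by omega, fun θ h => ?_⟩, by omega⟩
        have := h.time_lt
        have := downClosed_cutAvoiding _ _ h ht
        omega
      · exact Or.inl (by omega)
    · by_cases ht : r.cutAvoiding Θ e b ≤ t - e
      · refine Or.inr ⟨⟨by omega, fun θ h => ?_⟩, by omega⟩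
        have := h.time_lt
        omega
      · exact Or.inl (by omega)

variable (r Θ e) in
theorem Schedule.eventuallyLags_postpone : (postpone r Θ e).EventuallyLags e := by
  filter_upwards [Filter.eventually_ge_atTop e] with t ht b
  have hle := cutAvoiding_le (r := r) (Θ := Θ) (e := e) (b := b)
  simp only [postpone]
  omega

theorem Schedule.punctual_postpone (h : ∀ u < e, (b, u) ∉ r.future Θ) :
    (postpone r Θ e).Punctual b e := by
  intro u hu
  have hle : e ≤ r.cutAvoiding Θ e b := not_lt.1 fun hlt =>
    (lt_cutAvoiding_iff.not.1 (lt_irrefl _)) ⟨hlt, h _ hlt⟩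
  simp only [postpone]
  omega

theorem Schedule.not_mem_of_postpone_cut_lt (ht : t < e)
    (h : (postpone r Θ e).cut t b < (postpone r Θ e).cut (t + 1) b) :
    (b, (postpone r Θ e).cut t b) ∉ Θ := by
  have hlt : (postpone r Θ e).cut t b < r.cutAvoiding Θ e b := by
    simp only [postpone] at h ⊢
    omega
  exact fun hΘ => (lt_cutAvoiding_iff.1 hlt).2 ⟨_, hΘ, Or.inl rfl⟩

end Postponing

section FeedbackLoops

variable {r} {i : Fin n} {θ θ' : Agent n × ℕ}

theorem isSync_of_accesses (h : (r.ev t (.proc i)).Accesses x)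
    (hread : ¬ (r.ev t (.proc i)).IsRfM) : (r.ev t (.proc i)).IsSync := by
  obtain ⟨σ, hσ⟩ := r.enabled t (.proc i)
  rcases h with ⟨v, h⟩ | ⟨v, v', h⟩ | ⟨v, k, h⟩
  exacts [absurd ⟨x, v, h⟩ hread, Or.inr ⟨x, v, v', h⟩, absurd ⟨x, v, k, h⟩ hσ.not_isProp]

theorem isProp_of_accesses (h : (r.ev t (.disp i)).Accesses x) : (r.ev t (.disp i)).IsProp := by
  obtain ⟨σ, hσ⟩ := r.enabled t (.disp i)
  refine hσ.isProp_or_eq_null.resolve_right fun hnull => ?_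
  simp [hnull, Event.Accesses] at h

-- An own read is not ordered after a propagation, so a chain of events from `d_i` to `i` that
-- avoids all other agents has to use a fence or a read-modify-write.
theorem OccursBefore.of_disp (h : r.OccursBefore θ θ') (hθ : θ.1 = .disp i) :
    θ'.1 = .disp i ∨ (∃ u, θ.2 < u ∧ u ≤ θ'.2 ∧ (r.ev u (.proc i)).IsSync) ∨
      ∃ b u, b ≠ .proc i ∧ b ≠ .disp i ∧ r.OccursBefore θ (b, u) ∧
        ((b, u) = θ' ∨ r.OccursBefore (b, u) θ') := by
  induction h with
  | locality => exact Or.inl hθ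
  | buffer => cases hθ
  | sync j t t' h hprop hsync =>
    cases hθ
    exact Or.inr (Or.inl ⟨t', h, le_rfl, hsync⟩)
  | memory b c t t' h x hb hc hreads hown =>
    obtain rfl : b = .disp i := hθ
    by_cases hcd : c = .disp i
    · exact Or.inl hcd
    by_cases hcp : c = .proc i
    · subst hcp
      have hsync := isSync_of_accesses hc fun hread =>
        hown ⟨i, rfl, rfl, isProp_of_accesses hb, hread⟩
      exact Or.inr (Or.inl ⟨t', h, le_rfl, hsync⟩)
    · exact Or.inr (Or.inr
        ⟨c, t', hcp, hcd, .memory _ c t t' h x hb hc hreads hown, Or.inl rfl⟩)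
  | trans θ θ₁ θ₂ h₁ h₂ ih₁ ih₂ =>
    rcases ih₁ hθ with hθ₁ | ⟨u, hu, hu', hsync⟩ | ⟨b, u, hbp, hbd, h, h'⟩
    · rcases ih₂ hθ₁ with hθ₂ | ⟨u, hu, hu', hsync⟩ | ⟨b, u, hbp, hbd, h, h'⟩
      · exact Or.inl hθ₂
      · exact Or.inr (Or.inl ⟨u, h₁.time_lt.trans hu, hu', hsync⟩)
      · exact Or.inr (Or.inr ⟨b, u, hbp, hbd, .trans _ _ _ h₁ h, h'⟩)
    · exact Or.inr (Or.inl ⟨u, hu, hu'.trans h₂.time_lt.le, hsync⟩)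
    · refine Or.inr (Or.inr ⟨b, u, hbp, hbd, h, Or.inr ?_⟩)
      rcases h' with rfl | h'
      exacts [h₂, .trans _ _ _ h' h₂]

theorem not_occursBefore_of_not_feedbackLoop {e p : ℕ} (hloop : ¬ r.FeedbackLoop i t e)
    (hp : r.OccursBefore (.proc i, t) (.disp i, p)) (hu : u < e)
    (hsync : ∀ w, t < w → w ≤ u → ¬ (r.ev w (.proc i)).IsSync) :
    ¬ r.OccursBefore (.disp i, p) (.proc i, u) := by
  intro h
  have hlast : r.OccursBefore (.proc i, u) (.proc i, e) := .locality _ _ _ hu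
  rcases h.of_disp rfl with hi | ⟨w, hpw, hwu, hw⟩ | ⟨b, w, hbp, hbd, hpb, hb | hb⟩
  · cases hi
  · exact hsync w (hp.time_lt.trans hpw) hwu hw
  · exact hbp (congrArg Prod.fst hb)
  · exact hloop ⟨b, w, hbp, hbd, .trans _ _ _ hp hpb, .trans _ _ _ hb hlast⟩

theorem not_mem_future_of_not_feedbackLoop {e : ℕ} (ht : r.WritesTag i k t)
    (hloop : ¬ r.FeedbackLoop i t e)
    (hsync : ∀ u, t < u → u < e → ¬ (r.ev u (.proc i)).IsSync) (hu : u < e) :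
    (.proc i, u) ∉ r.future {θ | θ.1 = .disp i ∧ r.PropagatesTag i k θ.2} := by
  rintro ⟨⟨b, p⟩, ⟨rfl : b = _, hp⟩, h | h⟩
  · cases h
  · have htp := ht.lt_of_propagatesTag hp
    obtain ⟨x, v, hw⟩ := ht
    exact not_occursBefore_of_not_feedbackLoop hloop
      (.buffer i t p htp k (Or.inl ⟨x, v, hw⟩) hp) hu
      (fun w htw hwu => hsync w htw (hwu.trans_lt hu)) h

end FeedbackLoops

end Run

end TSO

open TSO Run in
theorem mainTheorem3_general {n : ℕ} {Var Val Op Inn : Type*} [DecidableEq Var]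
    (P : TSO.Protocol n Var Val Op Inn) (r : TSO.Run n Var Val Op Inn) (hP : r.IsRunOf P)
    (i : Fin n) (m : ℕ) (o : Op) (s e : ℕ) (hX : r.OpOccurs i m o s e)
    (k t : ℕ) (hst : s ≤ t) (hte : t < e) (hwrite : r.WritesTag i k t)
    (hloop : ¬ r.FeedbackLoop i t e)
    (hsync : ∀ u, t < u → u < e → ¬ (r.ev u (.proc i)).IsSync) :
    ∃ r' : TSO.Run n Var Val Op Inn,
      r'.IsRunOf P ∧ r.LocallyEquiv r' ∧ r'.tso 0 = r.tso 0 ∧ (r.Fair P → r'.Fair P) ∧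
      ∃ s' e', r'.OpOccurs i m o s' e' ∧ (∃ t, s' ≤ t ∧ t < e' ∧ r'.WritesTag i k t) ∧
        ∀ t, t < e' → ¬ r'.PropagatesTag i k t := by
  let S := Schedule.postpone r {θ | θ.1 = .disp i ∧ r.PropagatesTag i k θ.2} e
  have hlag : S.EventuallyLags e := Schedule.eventuallyLags_postpone _ _ _
  have hpunctual : S.Punctual (.proc i) e := Schedule.punctual_postpone fun u hu =>
    not_mem_future_of_not_feedbackLoop hwrite hloop hsync hu
  refine ⟨S.run, S.isRunOf_run hP, hlag.locallyEquiv_run, rfl, hlag.fair_run, s, e,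
    hpunctual.opOccurs_run hX, ⟨t, hst, hte, hpunctual.writesTag_run hte hwrite⟩, ?_⟩
  intro u hu hprop
  obtain ⟨hlt, hprop'⟩ := Schedule.cut_lt_and_propagatesTag_of_run hprop
  exact Schedule.not_mem_of_postpone_cut_lt hu hlt ⟨rfl, hprop'⟩

theorem mainTheorem3 {n : ℕ} {Var Val Op Inn : Type*} [DecidableEq Var]
    (P : TSO.Protocol n Var Val Op Inn) (r : TSO.Run n Var Val Op Inn) (hP : r.IsRunOf P)
    (i : Fin n) (m : ℕ) (o : Op) (s e : ℕ) (hX : r.OpOccurs i m o s e)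
    (k : ℕ) (hwrite : ∃ t, s ≤ t ∧ t < e ∧ r.WritesTag i k t)
    (hloop : ¬ r.FeedbackLoop i s e)
    (hsync : ∀ t, s ≤ t → t < e → ¬ (r.ev t (.proc i)).IsSync) :
    ∃ r' : TSO.Run n Var Val Op Inn,
      r'.IsRunOf P ∧ r.LocallyEquiv r' ∧ r'.tso 0 = r.tso 0 ∧ (r.Fair P → r'.Fair P) ∧
      ∃ s' e', r'.OpOccurs i m o s' e' ∧ (∃ t, s' ≤ t ∧ t < e' ∧ r'.WritesTag i k t) ∧
        ∀ t, t < e' → ¬ r'.PropagatesTag i k t := by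
  obtain ⟨t, hst, hte, ht⟩ := hwrite
  refine mainTheorem3_general P r hP i m o s e hX k t hst hte ht ?_
    fun u htu => hsync u (hst.trans htu.le)
  rintro ⟨b, u, hbp, hbd, htu, hue⟩
  refine hloop ⟨b, u, hbp, hbd, ?_, hue⟩
  exact hst.eq_or_lt.elim (fun h => h ▸ htu) fun h => .trans _ _ _ (.locality _ _ _ h) htu
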